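/- Let $N\ge 2$ and $p$ be natural numbers and let $\mathcal G$ be a connected, simple, undirected weighted graph on $\{1,\dots,N\}$ with symmetric weighted adjacency matrix $(a_{ij})$ ($a_{ij}>0$ if $\{i,j\}$ is an edge, $a_{ij}=0$ otherwise, $a_{ii}=0$). Let $L$ be its Laplacian ($l_{ij}=-a_{ij}$ for $i\ne j$, $l_{ii}=\sum_{k\ne i}a_{ik}$), with eigenvalues $0=\lambda_1<\lambda_2\le\dots\le\lambda_N$. Let $B\in\mathbb R^p$ and $S_1(0),\dots,S_N(0)\in\mathbb R^{p\times p}$, and consider, for $t=0,1,2,\dots$ and $i=1,\dots,N$, \[ \xi_i(t+1)=S_i(t)\xi_i(t)+Bu_i(t),\qquad u_i(t)=K_i(t)\sum_{j=1}^N a_{ij}(\xi_j(t)-\xi_i(t)), \] \[ S_i(t+1)=S_i(t)+c\sum_{j=1}^N a_{ij}(S_j(t)-S_i(t)), \] with states $\xi_i(t)\in\mathbb R^p$, a coupling strength $c\in\mathbb R$ and gains (row vectors) $K_i(t)\in\mathbb R^{1\times p}$. The system is said to synchronize if $\lim_{t\to\infty}\|\xi_i(t)-\xi_j(t)\|=0$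 for all $i,j$ and all initial states $\xi_1(0),\dots,\xi_N(0)\in\mathbb R^p$. Let $S_\infty=\frac1N\sum_{j=1}^N S_j(0)$, let $\rho$ denote the spectral radius, and let $\pi=\prod_j|\lambda^u_j(S_\infty)|$ be the product of the moduli of the (complex) eigenvalues of $S_\infty$ of modulus at least $1$, counted with multiplicity. Assume that 1. $(S_\infty,B)$ is stabilizable, i.e. $\rho(S_\infty+BF)<1$ for some $F\in\mathbb R^{1\times p}$; 2. $\rho(S_\infty)\ge 1$; 3. $\displaystyle \pi^{-1}>\frac{\lambda_N-\lambda_2}{\lambda_N+\lambda_2}$. Then there are $c$ and gains $K_i(t)$ depending only on $S_i(t)$ for which the system synchronizes. Specifically: (a) the interval $\left(\frac{1-1/\rho(S_\infty)}{\lambda_2},\frac{1+1/\rho(S_\infty)}{\lambda_N}\right)$ is non-empty, and for every $\eta$ with $\frac{\lambda_N-\lambda_2}{\lambda_N+\lambda_2}\le\eta<\pi^{-1}$ there is a positive definite matrix $P\in\mathbb R^{p\times p}$ with \[ P-S_\infty^TPS_\infty+(1-\eta^2)\,\frac{S_\infty^TPBB^TPS_\infty}{B^TPB}>0 ; \] (b)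 for every $c$ in that interval, every such $\eta$ and every positive definite $P$ satisfying this inequality, the system with \[ K_i(t)=\frac{2}{\lambda_2+\lambda_N}\,\frac{B^TPS_i(t)}{B^TPB} \] synchronizes. -/

import Mathlib

open Filter Topology Matrix

/-- A simple undirected weighted graph on the nodes `0, …, N - 1`: a simple graph together with a
symmetric weighted adjacency matrix that is positive on edges and zero elsewhere (in particular on
the diagonal). -/
structure WeightedGraph (N : ℕ) where
  graph : SimpleGraph (Fin N)
  weight : Matrix (Fin N) (Fin N) ℝ
  weight_symm : ∀ i j, weight i j = weight j i
  weight_pos : ∀ i j, graph.Adj i j → 0 < weight i j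
  weight_zero : ∀ i j, ¬ graph.Adj i j → weight i j = 0

namespace WeightedGraph

variable {N : ℕ}

/-- The Laplacian matrix: weighted degrees on the diagonal, `-a i j` off the diagonal. -/
def laplacian (G : WeightedGraph N) : Matrix (Fin N) (Fin N) ℝ :=
  Matrix.of fun i j =>
    if i = j then ∑ k ∈ Finset.univ.erase i, G.weight i k else -G.weight i j

theorem laplacian_isHermitian (G : WeightedGraph N) : G.laplacian.IsHermitian := by
  ext i j
  by_cases h : i = j
  · subst h
    simp [laplacian]
  · have h' : ¬ j = i := fun e => h e.symm
    simp [laplacian, h, h', G.weight_symm i j]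

/-- The eigenvalues of the Laplacian, with multiplicity, in nondecreasing order (Mathlib's
`eigenvalues₀` lists them in nonincreasing order). The smallest one has index `0`, so that the
eigenvalue usually written `λ_k` has index `k - 1`. -/
noncomputable def eigenvalue (G : WeightedGraph N) (k : Fin N) : ℝ :=
  G.laplacian_isHermitian.eigenvalues₀ (Fin.cast (Fintype.card_fin N).symm k.rev)

end WeightedGraph

namespace MultiAgent

variable {N p : ℕ}

/-- A real square matrix regarded as a complex one. -/
noncomputable def toComplex (A : Matrix (Fin p) (Fin p) ℝ) : Matrix (Fin p) (Fin p) ℂ :=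
  A.map (algebraMap ℝ ℂ)

/-- The spectral radius of a real square matrix: the maximum modulus of its complex eigenvalues. -/
noncomputable def rho (A : Matrix (Fin p) (Fin p) ℝ) : ℝ :=
  (spectralRadius ℂ (toComplex A)).toReal

/-- The product of the moduli of the complex eigenvalues of modulus at least `1`, counted with
algebraic multiplicity. -/
noncomputable def unstableProd (A : Matrix (Fin p) (Fin p) ℝ) : ℝ :=
  (((toComplex A).charpoly.roots.filter fun z => 1 ≤ ‖z‖).map fun z => ‖z‖).prod

/-- `(A, B)` is stabilizable (discrete time, single input): some static state feedback makes the
closed-loop matrix `A + B F` Schur stable. -/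
def Stabilizable (A : Matrix (Fin p) (Fin p) ℝ) (B : Fin p → ℝ) : Prop :=
  ∃ F : Fin p → ℝ, rho (A + vecMulVec B F) < 1

/-- The average of the agents' initial system matrices. -/
noncomputable def average (S₀ : Fin N → Matrix (Fin p) (Fin p) ℝ) : Matrix (Fin p) (Fin p) ℝ :=
  (1 / (N : ℝ)) • ∑ j, S₀ j

/-- The system matrices: `S_i(0) = S₀ i`, `S_i(t+1) = S_i(t) + c ∑_j a_ij (S_j(t) - S_i(t))`. -/
noncomputable def systemMatrix (G : WeightedGraph N) (c : ℝ)
    (S₀ : Fin N → Matrix (Fin p) (Fin p) ℝ) : ℕ → Fin N → Matrix (Fin p) (Fin p) ℝ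
  | 0 => S₀
  | t + 1 => fun i =>
      systemMatrix G c S₀ t i +
        c • ∑ j, G.weight i j • (systemMatrix G c S₀ t j - systemMatrix G c S₀ t i)

/-- The agents' states: `ξ_i(t+1) = S_i(t) ξ_i(t) + B u_i(t)` with the scalar input
`u_i(t) = K_i(t) ∑_j a_ij (ξ_j(t) - ξ_i(t))`, where the row vector `K_i(t) = K (S_i(t))` depends on
`S_i(t)` only. -/
noncomputable def state (G : WeightedGraph N) (c : ℝ) (B : Fin p → ℝ)
    (K : Matrix (Fin p) (Fin p) ℝ → Fin p → ℝ) (S₀ : Fin N → Matrix (Fin p) (Fin p) ℝ)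
    (ξ₀ : Fin N → Fin p → ℝ) : ℕ → Fin N → Fin p → ℝ
  | 0 => ξ₀
  | t + 1 => fun i =>
      systemMatrix G c S₀ t i *ᵥ state G c B K S₀ ξ₀ t i +
        (K (systemMatrix G c S₀ t i) ⬝ᵥ
          ∑ j, G.weight i j • (state G c B K S₀ ξ₀ t j - state G c B K S₀ ξ₀ t i)) • B

/-- The multiagent system achieves synchronization: for all initial states, all the Euclidean
distances `‖ξ_i(t) - ξ_j(t)‖` tend to `0`. -/
def Synchronizes (G : WeightedGraph N) (c : ℝ) (B : Fin p → ℝ)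
    (K : Matrix (Fin p) (Fin p) ℝ → Fin p → ℝ) (S₀ : Fin N → Matrix (Fin p) (Fin p) ℝ) : Prop :=
  ∀ ξ₀ : Fin N → Fin p → ℝ, ∀ i j : Fin N,
    Tendsto (fun t : ℕ =>
        ‖WithLp.toLp 2 (state G c B K S₀ ξ₀ t i - state G c B K S₀ ξ₀ t j)‖)
      atTop (𝓝 0)

/-- `P` is a positive definite solution of the modified Riccati inequality
`P - Aᵀ P A + (1 - η²) (Aᵀ P B Bᵀ P A) / (Bᵀ P B) > 0`. -/
def SolvesRiccati (A : Matrix (Fin p) (Fin p) ℝ) (B : Fin p → ℝ) (η : ℝ)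
    (P : Matrix (Fin p) (Fin p) ℝ) : Prop :=
  P.PosDef ∧
    (P - Aᵀ * P * A +
      ((1 - η ^ 2) / (B ⬝ᵥ (P *ᵥ B))) • (Aᵀ * P * vecMulVec B B * P * A)).PosDef

/-- The feedback law `S ↦ g Bᵀ P S / (Bᵀ P B)`. -/
noncomputable def gain (g : ℝ) (B : Fin p → ℝ) (P S : Matrix (Fin p) (Fin p) ℝ) : Fin p → ℝ :=
  (g / (B ⬝ᵥ (P *ᵥ B))) • (B ᵥ* (P * S))

end MultiAgent

/-! In an orthonormal eigenbasis of the Laplacian, the matrices `S_i(t)` split into modes multiplied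
by `1 - c λ_k` at each step. The constant mode is the conserved average; for `c` in the stated
interval the others decay like `r ^ t` with `r * ρ(S∞) < 1` (`exists_systemMatrix_bound`). As the
gain is linear in `S`, the modes of the states follow the matrices `S∞ - λ_k H S∞`, `H = g B Bᵀ P /
(Bᵀ P B)`, up to an error `O(r ^ t)` times the size of all modes (`exists_mode_bound`). With `g = 2
/ (λ₂ + λ_N)` one has `|1 - g λ_k| ≤ η` off the constant mode, and completing a square shows that
`P` is a Lyapunov form for each of these matrices (`SolvesRiccati.rho_lt_one`). The constant mode
may grow, but only at rates just above `ρ(S∞)`, so the factor `r ^ t` defeats its influence on the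
others (`tendsto_zero_of_perturbed_modes`). Differences of agents do not see the constant mode.

The harder half is the existence of `P`. Scale `S∞` by `s > 1` close to `1`, so that no eigenvalue
lies on the unit circle and none crosses it from inside. The Riccati equation without state cost is
solved by reflecting unstable eigenvalues into the disc one at a time by rank one terms; each
reflection multiplies the effective input weight by `|a| ^ 2`, whence `1 + Bᵀ P B` is the squared
unstable product (`exists_isStabilizing`). Uniqueness makes `P` real. The bound on `η` turns the
equation into a weak inequality, strict where the form of `P` is positive; adding a small multiple
of a Lyapunov form of the closed loop makes it strict everywhere (`exists_solvesRiccati`). -/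

namespace MultiAgent

/-! ### Spectral radius, adapted norms and Lyapunov forms -/

section Spectral

attribute [local instance] Matrix.linftyOpNormedRing Matrix.linftyOpNormedAlgebra

variable {n : Type*} [Fintype n] [DecidableEq n]

theorem spectralRadius_matrix_ne_top (A : Matrix n n ℂ) : spectralRadius ℂ A ≠ ⊤ := by
  cases isEmpty_or_nonempty n
  · have : Subsingleton (Matrix n n ℂ) := inferInstance
    simp [spectrum.SpectralRadius.of_subsingleton]
  · exact ((spectrum.spectralRadius_le_nnnorm A).trans_lt ENNReal.coe_lt_top).ne

theorem norm_le_spectralRadius_toReal {A : Matrix n n ℂ} {z : ℂ} (hz : z ∈ spectrum ℂ A) :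
    ‖z‖ ≤ (spectralRadius ℂ A).toReal := by
  have h : (‖z‖₊ : ENNReal) ≤ spectralRadius ℂ A :=
    le_iSup₂ (f := fun (k : ℂ) (_ : k ∈ spectrum ℂ A) => (‖k‖₊ : ENNReal)) z hz
  simpa using ENNReal.toReal_mono (spectralRadius_matrix_ne_top A) h

theorem exists_norm_eq_spectralRadius_toReal [Nonempty n] (A : Matrix n n ℂ) :
    ∃ z ∈ spectrum ℂ A, ‖z‖ = (spectralRadius ℂ A).toReal := by
  obtain ⟨z, hz, h⟩ := spectrum.exists_nnnorm_eq_spectralRadius A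
  exact ⟨z, hz, by rw [← h]; simp⟩

/-- Powers of a matrix grow no faster than the powers of any number exceeding its spectral
radius. -/
theorem eventually_norm_pow_le (A : Matrix n n ℂ) {μ : ℝ}
    (hμ : (spectralRadius ℂ A).toReal < μ) : ∀ᶠ k : ℕ in atTop, ‖A ^ k‖ ≤ μ ^ k := by
  have hμ0 : 0 ≤ μ := ENNReal.toReal_nonneg.trans hμ.le
  have hlt : spectralRadius ℂ A < ENNReal.ofReal μ := by
    rw [← ENNReal.ofReal_toReal (spectralRadius_matrix_ne_top A)]
    exact (ENNReal.ofReal_lt_ofReal_iff_of_nonneg ENNReal.toReal_nonneg).2 hμ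
  filter_upwards [(spectrum.pow_norm_pow_one_div_tendsto_nhds_spectralRadius A).eventually_lt_const
    hlt, eventually_ge_atTop 1] with k hk hk1
  have h := ((ENNReal.ofReal_lt_ofReal_iff_of_nonneg (by positivity)).1 hk).le
  have hk0 : (k : ℝ) ≠ 0 := by positivity
  calc ‖A ^ k‖ = (‖A ^ k‖ ^ (1 / k : ℝ)) ^ k := by
        rw [← Real.rpow_mul_natCast (norm_nonneg _), one_div, inv_mul_cancel₀ hk0, Real.rpow_one]
    _ ≤ μ ^ k := by gcongr

theorem mem_spectrum_iff_mem_roots {A : Matrix n n ℂ} {z : ℂ} :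
    z ∈ spectrum ℂ A ↔ z ∈ A.charpoly.roots := by
  rw [Matrix.mem_spectrum_iff_isRoot_charpoly, Polynomial.mem_roots A.charpoly_monic.ne_zero]

/-- A left eigenvector for every point of the spectrum. -/
theorem exists_vecMul_eq_smul {A : Matrix n n ℂ} {z : ℂ} (hz : z ∈ spectrum ℂ A) :
    ∃ w : n → ℂ, w ≠ 0 ∧ w ᵥ* A = z • w := by
  have h : (algebraMap ℂ (Matrix n n ℂ) z - A).det = 0 := by
    by_contra h
    exact hz ((Matrix.isUnit_iff_isUnit_det _).2 (isUnit_iff_ne_zero.2 h))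
  obtain ⟨w, hw, h⟩ := Matrix.exists_vecMul_eq_zero_iff.2 h
  refine ⟨w, hw, ?_⟩
  rw [Matrix.vecMul_sub, sub_eq_zero, Algebra.algebraMap_eq_smul_one] at h
  rw [← h]; simp [Matrix.vecMul_smul]

theorem exists_mulVec_eq_smul {A : Matrix n n ℂ} {z : ℂ} (hz : z ∈ spectrum ℂ A) :
    ∃ w : n → ℂ, w ≠ 0 ∧ A *ᵥ w = z • w := by
  have h : (algebraMap ℂ (Matrix n n ℂ) z - A).det = 0 := by
    by_contra h
    exact hz ((Matrix.isUnit_iff_isUnit_det _).2 (isUnit_iff_ne_zero.2 h))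
  obtain ⟨w, hw, h⟩ := Matrix.exists_mulVec_eq_zero_iff.2 h
  refine ⟨w, hw, ?_⟩
  rw [Matrix.sub_mulVec, sub_eq_zero, Algebra.algebraMap_eq_smul_one] at h
  rw [← h]; simp [Matrix.smul_mulVec]

theorem mem_spectrum_of_vecMul_eq_smul {A : Matrix n n ℂ} {z : ℂ} {w : n → ℂ} (hw : w ≠ 0)
    (h : w ᵥ* A = z • w) : z ∈ spectrum ℂ A := by
  intro hu
  have h0 : w ᵥ* (algebraMap ℂ (Matrix n n ℂ) z - A) = 0 := by
    rw [Matrix.vecMul_sub, h, Algebra.algebraMap_eq_smul_one]; simp [Matrix.vecMul_smul]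
  have := Matrix.exists_vecMul_eq_zero_iff.1 ⟨w, hw, h0⟩
  exact isUnit_iff_ne_zero.1 ((Matrix.isUnit_iff_isUnit_det _).1 hu) this

theorem spectralRadius_toReal_lt [Nonempty n] {A : Matrix n n ℂ} {μ : ℝ}
    (h : ∀ z ∈ A.charpoly.roots, ‖z‖ < μ) : (spectralRadius ℂ A).toReal < μ := by
  obtain ⟨z, hz, he⟩ := exists_norm_eq_spectralRadius_toReal A
  exact he ▸ h z (mem_spectrum_iff_mem_roots.1 hz)

variable {p : ℕ}

theorem toComplex_mulVec (A : Matrix (Fin p) (Fin p) ℝ) (x : Fin p → ℝ) :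
    toComplex A *ᵥ (fun i => (x i : ℂ)) = fun i => ((A *ᵥ x) i : ℂ) := by
  ext i; simp [toComplex, Matrix.mulVec, dotProduct]

theorem norm_toComplex (A : Matrix (Fin p) (Fin p) ℝ) : ‖toComplex A‖ = ‖A‖ := by
  simp [Matrix.linfty_opNorm_def, toComplex]

theorem toComplex_pow (A : Matrix (Fin p) (Fin p) ℝ) (k : ℕ) :
    toComplex (A ^ k) = toComplex A ^ k := 
  map_pow (algebraMap ℝ ℂ).mapMatrix A k

theorem eventually_norm_pow_le_of_rho_lt (A : Matrix (Fin p) (Fin p) ℝ) {μ : ℝ}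
    (hμ : rho A < μ) : ∀ᶠ k : ℕ in atTop, ‖A ^ k‖ ≤ μ ^ k := by
  filter_upwards [eventually_norm_pow_le (toComplex A) hμ] with k hk
  rwa [← norm_toComplex, toComplex_pow]

/-- A norm on vectors adapted to a matrix: equivalent to the sup norm, and the matrix expands it at
most by a factor slightly larger than the spectral radius. -/
theorem exists_adapted_norm (A : Matrix (Fin p) (Fin p) ℝ) {μ : ℝ} (hμ : rho A < μ) :
    ∃ (ν : (Fin p → ℝ) → ℝ) (C : ℝ), 0 ≤ C ∧ (∀ x, ‖x‖ ≤ ν x) ∧ (∀ x, ν x ≤ C * ‖x‖) ∧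
      (∀ x y, ν (x + y) ≤ ν x + ν y) ∧ ∀ x, ν (A *ᵥ x) ≤ μ * ν x := by
  have hμ0 : 0 < μ := ENNReal.toReal_nonneg.trans_lt hμ
  obtain ⟨k, hk, hk1⟩ := ((eventually_norm_pow_le_of_rho_lt A hμ).and (eventually_ge_atTop 1)).exists
  -- Applying `A` shifts this sum: up to the factor `μ`, the term `‖x‖` is traded for `‖A ^ k *ᵥ x‖
  -- * μ⁻¹ ^ k`, which is no larger because `‖A ^ k‖ ≤ μ ^ k`.
  refine ⟨fun x => ∑ j ∈ Finset.range k, ‖A ^ j *ᵥ x‖ * (μ⁻¹) ^ j,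
    ∑ j ∈ Finset.range k, ‖A ^ j‖ * (μ⁻¹) ^ j, by positivity, fun x => ?_, fun x => ?_,
    fun x y => ?_, fun x => ?_⟩
  · have := Finset.single_le_sum (f := fun j => ‖A ^ j *ᵥ x‖ * (μ⁻¹) ^ j)
      (fun j _ => by positivity) (Finset.mem_range.2 hk1)
    simpa using this
  · rw [Finset.sum_mul]
    refine Finset.sum_le_sum fun j _ => ?_
    rw [mul_right_comm]
    gcongr
    exact Matrix.linfty_opNorm_mulVec _ _
  · rw [← Finset.sum_add_distrib]
    refine Finset.sum_le_sum fun j _ => ?_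
    rw [← add_mul, Matrix.mulVec_add]
    gcongr
    exact norm_add_le _ _
  · have h1 : ∀ j, ‖A ^ j *ᵥ (A *ᵥ x)‖ * (μ⁻¹) ^ j
        = μ * (‖A ^ (j + 1) *ᵥ x‖ * (μ⁻¹) ^ (j + 1)) := fun j => by
      rw [Matrix.mulVec_mulVec, ← pow_succ, pow_succ (μ⁻¹)]; field_simp
    simp only [h1]
    rw [← Finset.mul_sum]
    refine mul_le_mul_of_nonneg_left ?_ hμ0.le
    have h2 := Finset.sum_range_succ (fun j => ‖A ^ j *ᵥ x‖ * (μ⁻¹) ^ j) k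
    have h3 := Finset.sum_range_succ' (fun j => ‖A ^ j *ᵥ x‖ * (μ⁻¹) ^ j) k
    have h4 : ‖A ^ k *ᵥ x‖ * (μ⁻¹) ^ k ≤ ‖x‖ := by
      calc ‖A ^ k *ᵥ x‖ * (μ⁻¹) ^ k ≤ (μ ^ k * ‖x‖) * (μ⁻¹) ^ k := by
            gcongr
            exact (Matrix.linfty_opNorm_mulVec _ _).trans (by gcongr)
        _ = ‖x‖ := by rw [inv_pow]; field_simp
    simp only [pow_zero, Matrix.one_mulVec, mul_one] at h3
    linarith

theorem dotProduct_self_le (x : Fin p → ℝ) : x ⬝ᵥ x ≤ p * ‖x‖ ^ 2 := by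
  calc x ⬝ᵥ x = ∑ i, x i ^ 2 := by simp [dotProduct, sq]
    _ ≤ ∑ _i : Fin p, ‖x‖ ^ 2 := Finset.sum_le_sum fun i _ => by
        rw [← sq_abs]; have := norm_le_pi_norm x i; gcongr; exact this
    _ = _ := by simp

theorem sq_norm_le_dotProduct_self (x : Fin p → ℝ) : ‖x‖ ^ 2 ≤ x ⬝ᵥ x := by
  have h : ‖x‖ ≤ √(x ⬝ᵥ x) := by
    refine (pi_norm_le_iff_of_nonneg (Real.sqrt_nonneg _)).2 fun i => ?_
    refine Real.le_sqrt_of_sq_le ?_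
    rw [Real.norm_eq_abs, sq_abs, sq]
    exact Finset.single_le_sum (f := fun i => x i * x i) (fun i _ => mul_self_nonneg _)
      (Finset.mem_univ i)
  calc ‖x‖ ^ 2 ≤ √(x ⬝ᵥ x) ^ 2 := by gcongr
    _ = _ := Real.sq_sqrt (Finset.sum_nonneg fun i _ => mul_self_nonneg _)

/-- Lyapunov's theorem: a Schur stable matrix strictly decreases some positive definite form. -/
theorem exists_lyapunov (A : Matrix (Fin p) (Fin p) ℝ) (hA : rho A < 1) :
    ∃ X : Matrix (Fin p) (Fin p) ℝ, X.PosDef ∧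
      ∀ x, x ≠ 0 → (A *ᵥ x) ⬝ᵥ (X *ᵥ (A *ᵥ x)) < x ⬝ᵥ (X *ᵥ x) := by
  obtain ⟨μ, hμ, hμ1⟩ := exists_between hA
  have hμ0 : 0 ≤ μ := ENNReal.toReal_nonneg.trans hμ.le
  -- A finite sum of `(A ^ j)ᵀ * A ^ j` suffices once `A ^ k` contracts the Euclidean norm; the
  -- factor `p` pays for comparing it with the sup norm.
  have ht : Tendsto (fun k : ℕ => (p : ℝ) * (μ ^ k) ^ 2) atTop (𝓝 (p * 0 ^ 2)) :=
    ((tendsto_pow_atTop_nhds_zero_of_lt_one hμ0 hμ1).pow 2).const_mul _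
  have ht' := ht.eventually_lt_const (show (p : ℝ) * 0 ^ 2 < 1 by simp)
  obtain ⟨k, ⟨hk, hk1⟩, hk2⟩ :=
    (((eventually_norm_pow_le_of_rho_lt A hμ).and ht').and (eventually_ge_atTop 1)).exists
  have hq : ∀ x, x ⬝ᵥ ((∑ j ∈ Finset.range k, (A ^ j)ᵀ * A ^ j) *ᵥ x)
      = ∑ j ∈ Finset.range k, (A ^ j *ᵥ x) ⬝ᵥ (A ^ j *ᵥ x) := fun x => by
    rw [Matrix.sum_mulVec, dotProduct_sum]
    refine Finset.sum_congr rfl fun j _ => ?_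
    rw [← Matrix.mulVec_mulVec, Matrix.dotProduct_mulVec, Matrix.vecMul_transpose]
  have hnn : ∀ y : Fin p → ℝ, 0 ≤ y ⬝ᵥ y := fun y => Finset.sum_nonneg fun i _ => mul_self_nonneg _
  refine ⟨∑ j ∈ Finset.range k, (A ^ j)ᵀ * A ^ j, ?_, fun x hx => ?_⟩
  · refine Matrix.PosDef.of_dotProduct_mulVec_pos ?_ fun x hx => ?_
    · change _ᴴ = _
      rw [conjTranspose_sum]
      exact Finset.sum_congr rfl fun j _ => by simp
    · rw [star_trivial, hq]
      refine Finset.sum_pos' (fun j _ => hnn _) ⟨0, Finset.mem_range.2 hk2, ?_⟩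
      rw [pow_zero, one_mulVec]
      exact lt_of_le_of_ne (hnn x) fun h => hx (dotProduct_self_eq_zero.1 h.symm)
  · rw [hq, hq]
    have h2 := Finset.sum_range_succ (fun j => (A ^ j *ᵥ x) ⬝ᵥ (A ^ j *ᵥ x)) k
    have h3 := Finset.sum_range_succ' (fun j => (A ^ j *ᵥ x) ⬝ᵥ (A ^ j *ᵥ x)) k
    have h1 : ∀ j, A ^ j *ᵥ (A *ᵥ x) = A ^ (j + 1) *ᵥ x := fun j => by
      rw [Matrix.mulVec_mulVec, ← pow_succ]
    simp only [h1]
    simp only [pow_zero, Matrix.one_mulVec] at h3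
    have hx0 : 0 < ‖x‖ := norm_pos_iff.2 hx
    have h4 : (A ^ k *ᵥ x) ⬝ᵥ (A ^ k *ᵥ x) < x ⬝ᵥ x := by
      calc (A ^ k *ᵥ x) ⬝ᵥ (A ^ k *ᵥ x) ≤ p * ‖A ^ k *ᵥ x‖ ^ 2 := dotProduct_self_le _
        _ ≤ p * (μ ^ k * ‖x‖) ^ 2 := by
            gcongr
            exact (Matrix.linfty_opNorm_mulVec _ _).trans (by gcongr)
        _ = (p * (μ ^ k) ^ 2) * ‖x‖ ^ 2 := by ring
        _ < 1 * ‖x‖ ^ 2 := by gcongr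
        _ ≤ x ⬝ᵥ x := by rw [one_mul]; exact sq_norm_le_dotProduct_self x
    linarith

/-- A matrix that strictly decreases a positive definite form is Schur stable. -/
theorem rho_lt_one_of_lyapunov [NeZero p] {A P : Matrix (Fin p) (Fin p) ℝ} (hP : P.PosDef)
    (h : ∀ x, x ≠ 0 → (A *ᵥ x) ⬝ᵥ (P *ᵥ (A *ᵥ x)) < x ⬝ᵥ (P *ᵥ x)) : rho A < 1 := by
  refine spectralRadius_toReal_lt fun z hz => ?_
  obtain ⟨w, hw, hAw⟩ := exists_mulVec_eq_smul (mem_spectrum_iff_mem_roots.2 hz)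
  -- On the real span of the real and imaginary parts, `A` acts as multiplication by `z`, so the sum
  -- of the two values of the form is scaled by exactly `‖z‖ ^ 2`.
  set x : Fin p → ℝ := fun i => (w i).re
  set y : Fin p → ℝ := fun i => (w i).im
  have hx : A *ᵥ x = z.re • x - z.im • y := by
    ext i
    have := congrArg Complex.re (congrFun hAw i)
    simpa [toComplex, Matrix.mulVec, dotProduct, x, y] using this
  have hy : A *ᵥ y = z.im • x + z.re • y := by
    ext i
    have := congrArg Complex.im (congrFun hAw i)
    rw [add_comm]
    simpa [toComplex, Matrix.mulVec, dotProduct, x, y] using this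
  have hsymm : y ⬝ᵥ (P *ᵥ x) = x ⬝ᵥ (P *ᵥ y) := by
    have hPT : Pᵀ = P := by simpa using hP.isHermitian.eq
    rw [Matrix.dotProduct_mulVec, ← Matrix.mulVec_transpose, hPT, dotProduct_comm]
  have hnn : ∀ v, 0 ≤ v ⬝ᵥ (P *ᵥ v) := fun v => by
    simpa using hP.posSemidef.dotProduct_mulVec_nonneg v
  have hle : ∀ v, (A *ᵥ v) ⬝ᵥ (P *ᵥ (A *ᵥ v)) ≤ v ⬝ᵥ (P *ᵥ v) := fun v => by
    by_cases hv : v = 0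
    · simp [hv]
    · exact (h v hv).le
  have hid : (A *ᵥ x) ⬝ᵥ (P *ᵥ (A *ᵥ x)) + (A *ᵥ y) ⬝ᵥ (P *ᵥ (A *ᵥ y))
      = ‖z‖ ^ 2 * (x ⬝ᵥ (P *ᵥ x) + y ⬝ᵥ (P *ᵥ y)) := by
    rw [hx, hy]
    simp only [Matrix.mulVec_sub, Matrix.mulVec_add, Matrix.mulVec_smul, sub_dotProduct,
      add_dotProduct, dotProduct_sub, dotProduct_add, smul_dotProduct, dotProduct_smul, hsymm,
      smul_eq_mul]
    rw [← Complex.normSq_eq_norm_sq, Complex.normSq_apply]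
    ring
  have hlt : (A *ᵥ x) ⬝ᵥ (P *ᵥ (A *ᵥ x)) + (A *ᵥ y) ⬝ᵥ (P *ᵥ (A *ᵥ y))
      < x ⬝ᵥ (P *ᵥ x) + y ⬝ᵥ (P *ᵥ y) := by
    by_cases hx0 : x = 0
    · have hy0 : y ≠ 0 := fun hy0 => hw <| by
        ext i
        exact Complex.ext (congrFun hx0 i) (congrFun hy0 i)
      exact add_lt_add_of_le_of_lt (hle x) (h y hy0)
    · exact add_lt_add_of_lt_of_le (h x hx0) (hle y)
  rw [hid] at hlt
  by_contra! h1
  have : 1 ≤ ‖z‖ ^ 2 := one_le_pow₀ h1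
  nlinarith [hnn x, hnn y]

end Spectral

end MultiAgent

/-! ### The Riccati equation without state cost, by reflecting eigenvalues -/

namespace MultiAgent

section StabilizingSolution

open Polynomial ComplexConjugate ComplexOrder

variable {n : Type*} [Fintype n] [DecidableEq n]

/-- Adding to a matrix a rank one term along a left eigenvector moves that eigenvalue and leaves
the others alone. -/
theorem charpoly_sub_col_mul_row {A : Matrix n n ℂ} {W : Matrix Unit n ℂ} {U : Matrix n Unit ℂ}
    {a c : ℂ} (hW : W * A = a • W) (hU : W * U = (a - c) • 1) :
    (X - C a) * (A - U * W).charpoly = (X - C c) * A.charpoly := by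
  refine Polynomial.eq_of_infinite_eval_eq _ _ (Set.Infinite.mono (s := {a}ᶜ) ?_
    (Set.finite_singleton a).infinite_compl)
  intro z hz
  have hza : z - a ≠ 0 := sub_ne_zero.2 hz
  -- Since `W * (z - A) = (z - a) • W`, the perturbation factors through `z - A`; the remaining
  -- factor has determinant `(z - c) / (z - a)`.
  have hfac : scalar n z - (A - U * W) = (1 + ((z - a)⁻¹ • U) * W) * (scalar n z - A) := by
    have h : W * (scalar n z - A) = (z - a) • W := by
      rw [Matrix.mul_sub, hW, sub_smul]
      congr 1
      ext i j
      simp [mul_comm]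
    rw [Matrix.add_mul, Matrix.mul_assoc, h, Matrix.one_mul, Matrix.mul_smul, Matrix.smul_mul,
      smul_smul, mul_inv_cancel₀ hza, one_smul]
    abel
  have hdet : (1 + ((z - a)⁻¹ • U) * W).det = 1 + (z - a)⁻¹ * (a - c) := by
    rw [det_one_add_mul_comm, Matrix.mul_smul, hU, smul_smul, det_unique]
    simp
  simp only [Set.mem_ofPred_eq, eval_mul, eval_sub, eval_X, eval_C, eval_charpoly]
  rw [hfac, det_mul, hdet]
  field_simp
  ring

theorem roots_charpoly_sub_col_mul_row {A : Matrix n n ℂ} {W : Matrix Unit n ℂ}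
    {U : Matrix n Unit ℂ} {a c : ℂ} (hW : W * A = a • W) (hU : W * U = (a - c) • 1) :
    a ::ₘ (A - U * W).charpoly.roots = c ::ₘ A.charpoly.roots := by
  have h := congrArg roots (charpoly_sub_col_mul_row hW hU)
  rwa [roots_mul (mul_ne_zero (X_sub_C_ne_zero a) (charpoly_monic _).ne_zero),
    roots_mul (mul_ne_zero (X_sub_C_ne_zero c) (charpoly_monic _).ne_zero),
    roots_X_sub_C, roots_X_sub_C, Multiset.singleton_add, Multiset.singleton_add] at h

/-- The product of the moduli of the elements of modulus at least one. -/
noncomputable def expandingProd (s : Multiset ℂ) : ℝ :=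
  ((s.filter fun z => 1 ≤ ‖z‖).map fun z => ‖z‖).prod

theorem expandingProd_cons_of_le {a : ℂ} (h : 1 ≤ ‖a‖) (s : Multiset ℂ) :
    expandingProd (a ::ₘ s) = ‖a‖ * expandingProd s := by
  rw [expandingProd, Multiset.filter_cons_of_pos (p := fun z : ℂ => 1 ≤ ‖z‖) s h, Multiset.map_cons,
    Multiset.prod_cons, expandingProd]

theorem expandingProd_cons_of_lt {a : ℂ} (h : ‖a‖ < 1) (s : Multiset ℂ) :
    expandingProd (a ::ₘ s) = expandingProd s := by
  rw [expandingProd, Multiset.filter_cons_of_neg (p := fun z : ℂ => 1 ≤ ‖z‖) s (not_le.2 h),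
    expandingProd]

/-- `P` solves the Riccati equation `P = Aᴴ P A - Aᴴ P B Bᴴ P A / (r + Bᴴ P B)`, written in terms
of the feedback row `k`, and the closed loop matrix `A - B k` is Schur stable. -/
structure IsStabilizing (A : Matrix n n ℂ) (B : Matrix n Unit ℂ) (r : ℝ) (P : Matrix n n ℂ)
    (k : Matrix Unit n ℂ) : Prop where
  posSemidef : P.PosSemidef
  feedback : Bᴴ * P * (A - B * k) = (r : ℂ) • k
  riccati : P = Aᴴ * P * (A - B * k)
  stable : ∀ z ∈ (A - B * k).charpoly.roots, ‖z‖ < 1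

/-- Riccati equations compose: solving one for the closed loop matrix of another solves the sum. -/
theorem IsStabilizing.add {A A₁ : Matrix n n ℂ} {B : Matrix n Unit ℂ} {r R : ℝ}
    {P₁ P₂ : Matrix n n ℂ} {k₁ k₂ : Matrix Unit n ℂ} (hA₁ : A₁ = A - B * k₁)
    (hP₁ : P₁.PosSemidef) (hk₁ : Bᴴ * P₁ * A₁ = (r : ℂ) • k₁) (hric₁ : P₁ = Aᴴ * P₁ * A₁)
    (hR : Bᴴ * P₁ * B = ((R : ℂ) - r) • 1)
    (h₂ : IsStabilizing A₁ B R P₂ k₂) : IsStabilizing A B r (P₁ + P₂) (k₁ + k₂) := by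
  have hAc : A - B * (k₁ + k₂) = A₁ - B * k₂ := by
    rw [hA₁, Matrix.mul_add]; abel
  have hA : A = A₁ + B * k₁ := by rw [hA₁]; abel
  have hk₁' : Bᴴ * P₁ * A = (R : ℂ) • k₁ := by
    rw [hA, Matrix.mul_add, hk₁, ← Matrix.mul_assoc, hR, Matrix.smul_mul, Matrix.one_mul,
      ← add_smul]
    congr 1; ring
  have hk₁'' : Aᴴ * P₁ * B = (R : ℂ) • k₁ᴴ := by
    have := congrArg conjTranspose hk₁'
    simpa [conjTranspose_mul, show P₁ᴴ = P₁ from hP₁.isHermitian, Matrix.mul_assoc] using this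
  refine ⟨hP₁.add h₂.posSemidef, ?_, ?_, ?_⟩
  · rw [hAc, Matrix.mul_add, Matrix.add_mul, h₂.feedback, Matrix.mul_sub, hk₁, ← Matrix.mul_assoc,
      hR, Matrix.smul_mul, Matrix.one_mul, sub_smul, smul_add]
    abel
  · rw [hAc, Matrix.mul_add, Matrix.add_mul]
    -- The cross terms of the two stages cancel precisely because the second uses the updated weight
    -- `R = r + Bᴴ P₁ B`.
    have e1 : Aᴴ * P₁ * (A₁ - B * k₂) = P₁ - (R : ℂ) • (k₁ᴴ * k₂) := by
      rw [Matrix.mul_sub, ← hric₁, ← Matrix.mul_assoc, hk₁'', Matrix.smul_mul]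
    have e2 : Aᴴ * P₂ * (A₁ - B * k₂) = P₂ + (R : ℂ) • (k₁ᴴ * k₂) := by
      have h3 : Aᴴ = A₁ᴴ + k₁ᴴ * Bᴴ := by rw [hA, conjTranspose_add, conjTranspose_mul]
      rw [h3, Matrix.add_mul, Matrix.add_mul, ← h₂.riccati, Matrix.mul_assoc k₁ᴴ,
        Matrix.mul_assoc k₁ᴴ, h₂.feedback, Matrix.mul_smul]
    rw [e1, e2]; abel
  · rw [hAc]; exact h₂.stable

/-- A stabilizable pair without eigenvalues on the unit circle has a stabilizing solution of the
Riccati equation without state cost; the solution measures the product of the unstable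
eigenvalues. -/
theorem exists_isStabilizing (B : Matrix n Unit ℂ) (m : ℕ) : ∀ (A : Matrix n n ℂ) (r : ℝ), 0 < r →
    (A.charpoly.roots.filter fun z => 1 ≤ ‖z‖).card = m →
    (∀ z ∈ A.charpoly.roots, ‖z‖ ≠ 1) →
    (∀ (w : Matrix Unit n ℂ) (z : ℂ), w ≠ 0 → 1 ≤ ‖z‖ → w * A = z • w → w * B ≠ 0) →
    ∃ P k, IsStabilizing A B r P k ∧
      Bᴴ * P * B = ((r * expandingProd A.charpoly.roots ^ 2 - r : ℝ) : ℂ) • 1 := by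
  induction m with
  | zero =>
    intro A r hr hm h1 hB
    rw [Multiset.card_eq_zero] at hm
    refine ⟨0, 0, ⟨Matrix.PosSemidef.zero, by simp, by simp, ?_⟩, by simp [expandingProd, hm]⟩
    intro z hz
    rw [Matrix.mul_zero, sub_zero] at hz
    by_contra! hz1
    exact Multiset.eq_zero_iff_forall_notMem.1 hm z (Multiset.mem_filter.2 ⟨hz, hz1⟩)
  | succ m ih =>
    intro A r hr hm h1 hB
    obtain ⟨a, ha⟩ := Multiset.card_pos_iff_exists_mem.1 (by rw [hm]; exact Nat.succ_pos m)
    obtain ⟨haA, ha1⟩ := Multiset.mem_filter.1 ha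
    have halt : 1 < ‖a‖ := lt_of_le_of_ne ha1 (h1 a haA).symm
    have ha0 : a ≠ 0 := norm_pos_iff.1 (zero_lt_one.trans halt)
    have hac0 : conj a ≠ 0 := by simpa using ha0
    obtain ⟨w, hw0, hw⟩ := exists_vecMul_eq_smul (mem_spectrum_iff_mem_roots.2 haA)
    set W : Matrix Unit n ℂ := replicateRow Unit w with hWdef
    have hWA : W * A = a • W := by
      rw [hWdef, ← replicateRow_vecMul, hw]; rfl
    have hW0 : W ≠ 0 := fun h => hw0 (replicateRow_injective h)
    set b : ℂ := (W * B) () () with hb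
    have hWB : W * B = b • 1 := by ext i j; simp [hb]
    have hb0 : b ≠ 0 := fun h => hB W a hW0 ha1 hWA (by rw [hWB, h, zero_smul])
    have hBW : Bᴴ * Wᴴ = conj b • 1 := by
      rw [← conjTranspose_mul, hWB, conjTranspose_smul, conjTranspose_one]; rfl
    have haa : a * conj a = ((‖a‖ ^ 2 : ℝ) : ℂ) := by rw [Complex.mul_conj']; norm_cast
    have hbb : b * conj b = ((‖b‖ ^ 2 : ℝ) : ℂ) := by rw [Complex.mul_conj']; norm_cast
    have hbc0 : conj b ≠ 0 := by simpa using hb0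
    -- Chosen so that the rank one solution `α WᴴW` raises the input weight from `r` to `r * ‖a‖ ^
    -- 2`.
    set α : ℝ := r * (‖a‖ ^ 2 - 1) / ‖b‖ ^ 2 with hα
    have hαc : (α : ℂ) = r * (a * conj a - 1) / (b * conj b) := by
      rw [haa, hbb, hα]; push_cast; rfl
    have hα0 : 0 ≤ α := by
      have : 1 ≤ ‖a‖ ^ 2 := one_le_pow₀ ha1
      exact div_nonneg (mul_nonneg hr.le (by linarith)) (by positivity)
    -- The feedback `κ • W` moves `a` to its mirror image `(conj a)⁻¹` in the unit circle and keeps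
    -- the other eigenvalues.
    set κ : ℂ := (a - (conj a)⁻¹) / b with hκ
    have hWU : W * (κ • B) = (a - (conj a)⁻¹) • 1 := by
      rw [Matrix.mul_smul, hWB, smul_smul, hκ, div_mul_cancel₀ _ hb0]
    set A₁ : Matrix n n ℂ := A - (κ • B) * W with hA₁
    have hroots := roots_charpoly_sub_col_mul_row hWA hWU
    rw [← hA₁] at hroots
    have hclt : ‖(conj a)⁻¹‖ < 1 := by
      rw [norm_inv, RCLike.norm_conj]; exact inv_lt_one_of_one_lt₀ halt
    have hA₁k : A₁ = A - B * (κ • W) := by rw [hA₁, Matrix.smul_mul, Matrix.mul_smul]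
    have hWA₁ : W * A₁ = (conj a)⁻¹ • W := by
      rw [hA₁, Matrix.mul_sub, ← Matrix.mul_assoc, hWU, hWA, Matrix.smul_mul, Matrix.one_mul,
        ← sub_smul]
      congr 1; ring
    obtain ⟨P₂, k₂, h₂, hR₂⟩ := ih A₁ (r * ‖a‖ ^ 2) (by positivity) (by
        have := congrArg (fun s => (s.filter fun z : ℂ => 1 ≤ ‖z‖).card) hroots
        rw [Multiset.filter_cons_of_pos (p := fun z : ℂ => 1 ≤ ‖z‖) _ ha1, Multiset.card_cons,
          Multiset.filter_cons_of_neg (p := fun z : ℂ => 1 ≤ ‖z‖) _ (not_le.2 hclt), hm] at this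
        omega)
      (fun z hz => by
        have : z ∈ (conj a)⁻¹ ::ₘ A.charpoly.roots := hroots ▸ Multiset.mem_cons_of_mem hz
        rcases Multiset.mem_cons.1 this with rfl | h
        · exact hclt.ne
        · exact h1 z h)
      -- A left eigenvector that annihilates `B` does not notice feedback, so the Hautus condition
      -- passes to `A₁`.
      (fun v z hv hz hvA hvB => by
        refine hB v z hv hz ?_ hvB
        rwa [hA₁k, Matrix.mul_sub, ← Matrix.mul_assoc, hvB, Matrix.zero_mul, sub_zero] at hvA)
    have hBP : Bᴴ * ((α : ℂ) • (Wᴴ * W)) = (α * conj b) • W := by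
      rw [Matrix.mul_smul, ← Matrix.mul_assoc, hBW, Matrix.smul_mul, Matrix.one_mul, smul_smul]
    have hR₁ : Bᴴ * ((α : ℂ) • (Wᴴ * W)) * B = (((r * ‖a‖ ^ 2 : ℝ) : ℂ) - r) • 1 := by
      rw [hBP, Matrix.smul_mul, hWB, smul_smul]
      congr 1
      rw [Complex.ofReal_mul, ← haa, hαc]
      field_simp
    refine ⟨(α : ℂ) • (Wᴴ * W) + P₂, κ • W + k₂, IsStabilizing.add hA₁k
      ((posSemidef_conjTranspose_mul_self W).smul (by exact_mod_cast hα0)) ?_ ?_ hR₁ h₂, ?_⟩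
    · rw [hBP, Matrix.smul_mul, hWA₁, smul_smul, smul_smul]
      congr 1
      rw [hαc, hκ]
      field_simp
    · have hAW : Aᴴ * Wᴴ = conj a • Wᴴ := by
        rw [← conjTranspose_mul, hWA, conjTranspose_smul]; rfl
      rw [Matrix.mul_smul, Matrix.smul_mul, ← Matrix.mul_assoc, hAW, Matrix.mul_assoc, hWA₁,
        Matrix.smul_mul, Matrix.mul_smul, smul_smul, smul_smul, mul_assoc,
        mul_inv_cancel₀ hac0, mul_one]
    · rw [Matrix.mul_add, Matrix.add_mul, hR₁, hR₂, ← add_smul]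
      have := congrArg expandingProd hroots
      rw [expandingProd_cons_of_le ha1, expandingProd_cons_of_lt hclt] at this
      rw [← this]
      congr 1
      push_cast
      ring

end StabilizingSolution

end MultiAgent

/-! ### Uniqueness and reality of the stabilizing solution -/

namespace MultiAgent

section RealSolution

open Polynomial ComplexConjugate ComplexOrder
attribute [local instance] Matrix.linftyOpNormedRing Matrix.linftyOpNormedAlgebra

section

variable {n : Type*} [Fintype n] [DecidableEq n]

theorem tendsto_pow_zero_of_roots [Nonempty n] {A : Matrix n n ℂ}
    (h : ∀ z ∈ A.charpoly.roots, ‖z‖ < 1) : Tendsto (fun k : ℕ => A ^ k) atTop (𝓝 0) := by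
  obtain ⟨μ, hμ, hμ1⟩ := exists_between (spectralRadius_toReal_lt h)
  have hμ0 : 0 ≤ μ := ENNReal.toReal_nonneg.trans hμ.le
  exact squeeze_zero_norm' (eventually_norm_pow_le A hμ)
    (tendsto_pow_atTop_nhds_zero_of_lt_one hμ0 hμ1)

/-- The stabilizing solution of a Riccati equation is unique. -/
theorem IsStabilizing.unique [Nonempty n] {A : Matrix n n ℂ} {B : Matrix n Unit ℂ} {r : ℝ}
    (hr : 0 < r) {P P' : Matrix n n ℂ} {k k' : Matrix Unit n ℂ} (h : IsStabilizing A B r P k)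
    (h' : IsStabilizing A B r P' k') : P = P' ∧ k = k' := by
  have hP : Pᴴ = P := h.posSemidef.isHermitian
  have hP' : P'ᴴ = P' := h'.posSemidef.isHermitian
  set F := A - B * k with hF
  set F' := A - B * k' with hF'
  have e1 : F'ᴴ * P * F = P - (r : ℂ) • (k'ᴴ * k) := by
    rw [hF', conjTranspose_sub, conjTranspose_mul, Matrix.sub_mul, Matrix.sub_mul, ← h.riccati,
      Matrix.mul_assoc k'ᴴ, Matrix.mul_assoc k'ᴴ, h.feedback, Matrix.mul_smul]
  have e2 : F'ᴴ * P' * F = P' - (r : ℂ) • (k'ᴴ * k) := by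
    have hric : F'ᴴ * P' * A = P' := by
      have := congrArg conjTranspose h'.riccati
      rw [conjTranspose_mul, conjTranspose_mul, conjTranspose_conjTranspose, hP',
        ← Matrix.mul_assoc] at this
      exact this.symm
    have hfb : F'ᴴ * P' * B = (r : ℂ) • k'ᴴ := by
      have hf : Bᴴ * P' * F' = (r : ℂ) • k' := h'.feedback
      have := congrArg conjTranspose hf
      simpa [conjTranspose_mul, hP', Matrix.mul_assoc] using this
    rw [hF, Matrix.mul_sub, hric, ← Matrix.mul_assoc, hfb, Matrix.smul_mul]
  -- The difference is fixed by a map whose iterates tend to zero, both closed loops being stable.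
  have e3 : F'ᴴ * (P - P') * F = P - P' := by
    rw [Matrix.mul_sub F'ᴴ P P', Matrix.sub_mul, e1, e2]; abel
  have e4 : ∀ m : ℕ, (F' ^ m)ᴴ * (P - P') * F ^ m = P - P' := fun m => by
    induction m with
    | zero => simp
    | succ m ih =>
      rw [pow_succ F', pow_succ' F, conjTranspose_mul]
      calc F'ᴴ * (F' ^ m)ᴴ * (P - P') * (F * F ^ m)
          = ((F' ^ m)ᴴ * (F'ᴴ * (P - P') * F)) * F ^ m := by
            rw [← conjTranspose_mul, ← pow_succ, pow_succ', conjTranspose_mul]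
            simp only [Matrix.mul_assoc]
        _ = P - P' := by rw [e3, ih]
  have ht : Tendsto (fun m : ℕ => (F' ^ m)ᴴ * (P - P') * F ^ m) atTop
      (𝓝 ((0 : Matrix n n ℂ)ᴴ * (P - P') * 0)) := by
    have h1 : Tendsto (fun m : ℕ => (F' ^ m)ᴴ) atTop (𝓝 ((0 : Matrix n n ℂ)ᴴ)) :=
      ((continuous_id.matrix_conjTranspose).tendsto (0 : Matrix n n ℂ)).comp
        (tendsto_pow_zero_of_roots h'.stable)
    exact (h1.mul_const _).mul (tendsto_pow_zero_of_roots h.stable)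
  simp only [e4, Matrix.mul_zero] at ht
  have hPP : P = P' := sub_eq_zero.1 (tendsto_nhds_unique tendsto_const_nhds ht)
  refine ⟨hPP, ?_⟩
  -- The feedback is determined by `P`, as `r + Bᴴ P B` is positive.
  have hgain : ∀ {l : Matrix Unit n ℂ}, IsStabilizing A B r P l →
      (r + (Bᴴ * P * B) () ()) • l = Bᴴ * P * A := fun {l} hl => by
    have hsc : Bᴴ * P * B = (Bᴴ * P * B) () () • (1 : Matrix Unit Unit ℂ) := by ext i j; simp
    have := hl.feedback
    rw [Matrix.mul_sub, ← Matrix.mul_assoc, hsc, Matrix.smul_mul, Matrix.one_mul,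
      sub_eq_iff_eq_add, ← add_smul] at this
    exact this.symm
  have hpos : 0 ≤ (Bᴴ * P * B) () () := by
    have := (h.posSemidef.conjTranspose_mul_mul_same B).diag_nonneg (i := ())
    exact this
  have hne : (r : ℂ) + (Bᴴ * P * B) () () ≠ 0 := by
    have hrc : (0 : ℂ) < r := by exact_mod_cast hr
    exact (add_pos_of_pos_of_nonneg hrc hpos).ne'
  have := (hgain h).trans (hgain (hPP ▸ h')).symm
  exact smul_right_injective _ hne this

theorem roots_charpoly_map_conj (A : Matrix n n ℂ) :
    (A.map conj).charpoly.roots = A.charpoly.roots.map conj := by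
  rw [show A.map conj = A.map (starRingEnd ℂ) from rfl, charpoly_map]
  exact (IsAlgClosed.splits _).roots_map _

/-- Together with uniqueness, this forces the solution for real data to be real. -/
theorem IsStabilizing.map_conj {A : Matrix n n ℂ} {B : Matrix n Unit ℂ} {r : ℝ}
    {P : Matrix n n ℂ} {k : Matrix Unit n ℂ} (h : IsStabilizing A B r P k) :
    IsStabilizing (A.map conj) (B.map conj) r (P.map conj) (k.map conj) := by
  have hF : A.map conj - B.map conj * k.map conj = (A - B * k).map conj := by
    rw [Matrix.map_sub _ (map_sub _), Matrix.map_mul]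
  refine ⟨?_, ?_, ?_, ?_⟩
  · have : P.map conj = Pᵀ := by
      conv_rhs => rw [← show Pᴴ = P from h.posSemidef.isHermitian]
      rfl
    rw [this]; exact h.posSemidef.transpose
  · rw [hF, show (B.map conj)ᴴ = Bᴴ.map conj from rfl, ← Matrix.map_mul, ← Matrix.map_mul,
      h.feedback]
    ext i j; simp
  · rw [hF, show (A.map conj)ᴴ = Aᴴ.map conj from rfl, ← Matrix.map_mul, ← Matrix.map_mul,
      ← h.riccati]
  · rw [hF, roots_charpoly_map_conj]
    intro z hz
    obtain ⟨y, hy, rfl⟩ := Multiset.mem_map.1 hz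
    rw [RCLike.norm_conj]
    exact h.stable y hy

theorem charpoly_roots_smul (A : Matrix n n ℂ) {s : ℂ} (hs : s ≠ 0) :
    (s • A).charpoly.roots = A.charpoly.roots.map fun z => s * z := by
  have hA : A.charpoly = (A.charpoly.roots.map fun a => X - C a).prod :=
    ((IsAlgClosed.splits _).eq_prod_roots_of_monic A.charpoly_monic)
  have hcard : A.charpoly.roots.card = Fintype.card n := by
    rw [← (IsAlgClosed.splits _).natDegree_eq_card_roots, charpoly_natDegree_eq_dim]
  have h : (s • A).charpoly = ((A.charpoly.roots.map fun z => s * z).map fun a => X - C a).prod := by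
    refine Polynomial.funext fun z => ?_
    have h1 : scalar n z - s • A = s • (scalar n (s⁻¹ * z) - A) := by
      rw [smul_sub]
      congr 1
      ext i j
      by_cases hij : i = j <;> simp [Matrix.diagonal, hij, hs]
    rw [eval_charpoly, h1, det_smul, ← eval_charpoly, ← hcard]
    conv_lhs => rw [hA]
    rw [eval_multiset_prod, eval_multiset_prod, Multiset.map_map, Multiset.map_map, Multiset.map_map,
      roots_multiset_prod_X_sub_C, ← Multiset.prod_replicate, ← Multiset.map_const',
      ← Multiset.prod_map_mul]
    congr 1
    refine Multiset.map_congr rfl fun a _ => ?_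
    simp
    field_simp
  rw [h, roots_multiset_prod_X_sub_C]

end

variable {p : ℕ}

/-- A real stabilizable pair without eigenvalues on the unit circle has a real stabilizing solution
of the Riccati equation without state cost. -/
theorem exists_real_stabilizing [NeZero p] (A : Matrix (Fin p) (Fin p) ℝ)
    (B : Matrix (Fin p) Unit ℝ) (h1 : ∀ z ∈ (toComplex A).charpoly.roots, ‖z‖ ≠ 1)
    (hB : ∀ (w : Matrix Unit (Fin p) ℂ) (z : ℂ), w ≠ 0 → 1 ≤ ‖z‖ → w * toComplex A = z • w →
      w * B.map (algebraMap ℝ ℂ) ≠ 0) :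
    ∃ (P : Matrix (Fin p) (Fin p) ℝ) (k : Matrix Unit (Fin p) ℝ), P.PosSemidef ∧
      Bᵀ * P * (A - B * k) = k ∧ P = Aᵀ * P * (A - B * k) ∧ rho (A - B * k) < 1 ∧
      Bᵀ * P * B = (unstableProd A ^ 2 - 1) • 1 := by
  obtain ⟨P, k, h, hR⟩ := exists_isStabilizing _ _ (toComplex A) 1 one_pos rfl h1 hB
  have hAc : (toComplex A).map conj = toComplex A := by ext i j; simp [toComplex]
  have hBc : (B.map (algebraMap ℝ ℂ)).map conj = B.map (algebraMap ℝ ℂ) := by ext i j; simp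
  obtain ⟨hPc, hkc⟩ := IsStabilizing.unique one_pos (by simpa only [hAc, hBc] using h.map_conj) h
  have hP : P = (P.map Complex.re).map (algebraMap ℝ ℂ) := by
    ext i j
    exact (Complex.conj_eq_iff_re.1 (congrFun (congrFun hPc i) j)).symm
  have hk : k = (k.map Complex.re).map (algebraMap ℝ ℂ) := by
    ext i j
    exact (Complex.conj_eq_iff_re.1 (congrFun (congrFun hkc i) j)).symm
  set Q := P.map Complex.re
  set l := k.map Complex.re
  have hinj : ∀ {a b : Type} {M M' : Matrix a b ℝ},
      M.map (algebraMap ℝ ℂ) = M'.map (algebraMap ℝ ℂ) → M = M' := fun h =>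
    Matrix.map_injective (algebraMap ℝ ℂ).injective h
  have hT : ∀ {a b : Type} (M : Matrix a b ℝ), (M.map (algebraMap ℝ ℂ))ᴴ
      = Mᵀ.map (algebraMap ℝ ℂ) := fun M => by ext i j; simp
  have hF : toComplex A - B.map (algebraMap ℝ ℂ) * k = (A - B * l).map (algebraMap ℝ ℂ) := by
    rw [hk, Matrix.map_sub _ (map_sub _), Matrix.map_mul]; rfl
  refine ⟨Q, l, ?_, hinj ?_, hinj ?_, ?_, hinj ?_⟩
  · refine Matrix.PosSemidef.of_dotProduct_mulVec_nonneg ?_ fun x => ?_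
    · apply hinj
      rw [conjTranspose_eq_transpose_of_trivial, ← hT, ← hP]
      exact h.posSemidef.isHermitian
    · have := h.posSemidef.dotProduct_mulVec_nonneg (fun i => (x i : ℂ))
      rw [hP, show Q.map (algebraMap ℝ ℂ) = toComplex Q from rfl, toComplex_mulVec] at this
      have h2 : star (fun i => (x i : ℂ)) ⬝ᵥ (fun i => ((Q *ᵥ x) i : ℂ))
          = ((star x ⬝ᵥ (Q *ᵥ x) : ℝ) : ℂ) := by
        simp [dotProduct]
      rw [h2] at this
      exact_mod_cast this
  · have := h.feedback
    rw [hF, hT, hP, ← Matrix.map_mul, ← Matrix.map_mul, Complex.ofReal_one, one_smul] at this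
    rw [this, ← hk]
  · have := h.riccati
    rw [hF, show (toComplex A)ᴴ = _ from hT A, hP, ← Matrix.map_mul, ← Matrix.map_mul] at this
    exact this
  · refine spectralRadius_toReal_lt fun z hz => h.stable z ?_
    rw [hF]; exact hz
  · rw [hT, hP, ← Matrix.map_mul, ← Matrix.map_mul] at hR
    rw [hR]
    ext i j
    simp [unstableProd, expandingProd]

end RealSolution

end MultiAgent

/-! ### Solvability of the modified Riccati inequality -/

namespace MultiAgent

section RiccatiInequality

attribute [local instance] Matrix.linftyOpNormedRing Matrix.linftyOpNormedAlgebra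

variable {p : ℕ}

theorem one_le_expandingProd (s : Multiset ℂ) : 1 ≤ expandingProd s :=
  Multiset.one_le_prod fun x hx => by
    obtain ⟨z, hz, rfl⟩ := Multiset.mem_map.1 hx
    exact (Multiset.mem_filter.1 hz).2

theorem le_expandingProd {s : Multiset ℂ} {z : ℂ} (hz : z ∈ s) (h : 1 ≤ ‖z‖) :
    ‖z‖ ≤ expandingProd s := by
  obtain ⟨t, rfl⟩ := Multiset.exists_cons_of_mem hz
  rw [expandingProd_cons_of_le h]
  exact le_mul_of_one_le_right (norm_nonneg z) (one_le_expandingProd t)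

theorem one_le_unstableProd (A : Matrix (Fin p) (Fin p) ℝ) : 1 ≤ unstableProd A :=
  one_le_expandingProd _

/-- An eigenvalue of maximal modulus is one of the factors. This is what makes the interval for the
coupling strength non-empty. -/
theorem rho_le_unstableProd [NeZero p] {A : Matrix (Fin p) (Fin p) ℝ} (h : 1 ≤ rho A) :
    rho A ≤ unstableProd A := by
  obtain ⟨z, hz, he⟩ := exists_norm_eq_spectralRadius_toReal (toComplex A)
  rw [rho, ← he] at h ⊢
  exact le_expandingProd (mem_spectrum_iff_mem_roots.1 hz) h

/-- The spectrum in dimension zero is empty, so its radius is `0`. -/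
theorem pos_of_one_le_rho {A : Matrix (Fin p) (Fin p) ℝ} (h : 1 ≤ rho A) : NeZero p := by
  refine ⟨fun hp => ?_⟩
  subst hp
  simp only [rho, spectrum.SpectralRadius.of_subsingleton] at h
  norm_num at h

/-- A factor larger than one which keeps the contracting numbers contracting and increases the
product of the moduli of the others only slightly. -/
theorem exists_expanding_factor (S : Multiset ℂ) {η : ℝ} (hη : 0 ≤ η)
    (h : η * expandingProd S < 1) :
    ∃ s : ℝ, 1 < s ∧ (∀ z ∈ S, ‖z‖ < 1 → s * ‖z‖ < 1) ∧
      η * expandingProd (S.map fun z => (s : ℂ) * z) < 1 := by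
  have hlim : ∀ᶠ s in 𝓝 (1 : ℝ), s ^ S.card * (η * expandingProd S) < 1 := by
    have : Tendsto (fun s : ℝ => s ^ S.card * (η * expandingProd S)) (𝓝 1)
        (𝓝 (1 ^ S.card * (η * expandingProd S))) := Continuous.tendsto (by fun_prop) 1
    exact this.eventually_lt_const (by simpa using h)
  have hcontr : ∀ᶠ s in 𝓝 (1 : ℝ), ∀ z ∈ S.toFinset, ‖z‖ < 1 → s * ‖z‖ < 1 := by
    refine (Filter.eventually_all_finset _).2 fun z _ => ?_
    by_cases hz : ‖z‖ < 1
    · have : ∀ᶠ s in 𝓝 (1 : ℝ), s * ‖z‖ < 1 :=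
        (Continuous.tendsto (f := fun s : ℝ => s * ‖z‖) (by fun_prop) 1).eventually_lt_const
          (by simpa using hz)
      exact this.mono fun s hs _ => hs
    · exact Eventually.of_forall fun s h => absurd h hz
  obtain ⟨s, ⟨h1, h2⟩, hs⟩ := ((hlim.and hcontr).filter_mono
    (nhdsWithin_le_nhds (s := Set.Ioi 1)) |>.and self_mem_nhdsWithin).exists
  have hs1 : 1 < s := hs
  refine ⟨s, hs1, fun z hz => h2 z (Multiset.mem_toFinset.2 hz), lt_of_le_of_lt ?_ h1⟩
  have hle : ∀ T : Multiset ℂ, (∀ z ∈ T, ‖z‖ < 1 → s * ‖z‖ < 1) →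
      expandingProd (T.map fun z => (s : ℂ) * z) ≤ s ^ T.card * expandingProd T := by
    intro T
    induction T using Multiset.induction with
    | empty => simp [expandingProd]
    | cons a T ih =>
      intro hT
      have ih' := ih fun z hz => hT z (Multiset.mem_cons_of_mem hz)
      have hnorm : ‖(s : ℂ) * a‖ = s * ‖a‖ := by
        rw [norm_mul, Complex.norm_real, Real.norm_of_nonneg (by linarith)]
      have hT0 := one_le_expandingProd T
      rw [Multiset.map_cons, Multiset.card_cons]
      by_cases ha : 1 ≤ ‖a‖
      · rw [expandingProd_cons_of_le ha, expandingProd_cons_of_le (by rw [hnorm]; nlinarith), hnorm]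
        calc s * ‖a‖ * expandingProd (T.map fun z => (s : ℂ) * z)
            ≤ s * ‖a‖ * (s ^ T.card * expandingProd T) := by gcongr
          _ = _ := by ring
      · push Not at ha
        rw [expandingProd_cons_of_lt ha,
          expandingProd_cons_of_lt (by rw [hnorm]; exact hT a (Multiset.mem_cons_self _ _) ha)]
        refine ih'.trans ?_
        have : s ^ T.card ≤ s ^ (T.card + 1) := pow_le_pow_right₀ hs1.le (Nat.le_succ _)
        gcongr
  calc η * expandingProd (S.map fun z => (s : ℂ) * z)
      ≤ η * (s ^ S.card * expandingProd S) := by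
        gcongr
        exact hle S fun z hz => h2 z (Multiset.mem_toFinset.2 hz)
    _ = _ := by ring

/-- Positivity of a sum `f + δ g` on a compact set where `f` is nonnegative and `g` is positive on
the zeros of `f`. -/
theorem exists_pos_add_mul_pos {α : Type*} [TopologicalSpace α] {K : Set α} (hK : IsCompact K)
    {f g : α → ℝ} (hf : Continuous f) (hg : Continuous g) (hf0 : ∀ x ∈ K, 0 ≤ f x)
    (hfg : ∀ x ∈ K, f x = 0 → 0 < g x) : ∃ δ > 0, ∀ x ∈ K, 0 < f x + δ * g x := by
  have hL : IsCompact (K ∩ g ⁻¹' Set.Iic 0) := hK.inter_right (isClosed_Iic.preimage hg)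
  rcases (K ∩ g ⁻¹' Set.Iic 0).eq_empty_or_nonempty with he | hne
  · refine ⟨1, one_pos, fun x hx => ?_⟩
    have : 0 < g x := by
      by_contra! h
      exact Set.eq_empty_iff_forall_notMem.1 he x ⟨hx, h⟩
    linarith [hf0 x hx]
  · obtain ⟨x₀, ⟨hx₀, hgx₀⟩, hmin⟩ := hL.exists_isMinOn hne hf.continuousOn
    obtain ⟨x₁, ⟨hx₁, hgx₁⟩, hmin'⟩ := hL.exists_isMinOn hne hg.continuousOn
    have hfx₀ : 0 < f x₀ := lt_of_le_of_ne (hf0 x₀ hx₀) fun h =>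
      absurd (hfg x₀ hx₀ h.symm) (not_lt.2 hgx₀)
    have hd : 0 < 1 - g x₁ := by have : g x₁ ≤ 0 := hgx₁; linarith
    -- Where `g ≤ 0`, the sum is at least `f x₀ + δ * g x₁`, which equals `δ` for this choice.
    refine ⟨f x₀ / (1 - g x₁), div_pos hfx₀ hd, fun x hx => ?_⟩
    by_cases hgx : g x ≤ 0
    · have h1 : f x₀ ≤ f x := hmin ⟨hx, hgx⟩
      have h2 : g x₁ ≤ g x := hmin' ⟨hx, hgx⟩
      have h3 : f x₀ / (1 - g x₁) * (1 - g x₁) = f x₀ := div_mul_cancel₀ _ hd.ne'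
      have h4 : f x₀ / (1 - g x₁) * g x₁ ≤ f x₀ / (1 - g x₁) * g x :=
        mul_le_mul_of_nonneg_left h2 (div_pos hfx₀ hd).le
      have h5 := div_pos hfx₀ hd
      linarith
    · push Not at hgx
      have := mul_pos (div_pos hfx₀ hd) hgx
      linarith [hf0 x hx]

theorem dotProduct_mulVec_symm {P : Matrix (Fin p) (Fin p) ℝ} (hP : P.IsHermitian)
    (x y : Fin p → ℝ) : x ⬝ᵥ (P *ᵥ y) = y ⬝ᵥ (P *ᵥ x) := by
  have hPT : Pᵀ = P := by simpa using hP.eq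
  rw [Matrix.dotProduct_mulVec, ← Matrix.mulVec_transpose, hPT, dotProduct_comm]

/-- The quadratic form of the modified Riccati inequality. -/
theorem riccati_form (A P : Matrix (Fin p) (Fin p) ℝ) (hP : P.IsHermitian) (B x : Fin p → ℝ)
    (γ : ℝ) :
    x ⬝ᵥ ((P - Aᵀ * P * A + γ • (Aᵀ * P * vecMulVec B B * P * A)) *ᵥ x)
      = x ⬝ᵥ (P *ᵥ x) - (A *ᵥ x) ⬝ᵥ (P *ᵥ (A *ᵥ x)) + γ * (B ⬝ᵥ (P *ᵥ (A *ᵥ x))) ^ 2 := by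
  have hA : ∀ y, x ⬝ᵥ (Aᵀ *ᵥ y) = (A *ᵥ x) ⬝ᵥ y := fun y => by
    rw [Matrix.dotProduct_mulVec, Matrix.vecMul_transpose]
  rw [Matrix.add_mulVec, Matrix.sub_mulVec, Matrix.smul_mulVec]
  simp only [← Matrix.mulVec_mulVec, dotProduct_add, dotProduct_sub, dotProduct_smul, hA,
    Matrix.vecMulVec_mulVec, Matrix.mulVec_smul, smul_eq_mul,
    op_smul_eq_smul]
  rw [dotProduct_mulVec_symm hP (A *ᵥ x) B, sq]

theorem isHermitian_riccati (A P : Matrix (Fin p) (Fin p) ℝ) (hP : P.IsHermitian) (B : Fin p → ℝ)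
    (γ : ℝ) : (P - Aᵀ * P * A + γ • (Aᵀ * P * vecMulVec B B * P * A)).IsHermitian := by
  have hPT : Pᵀ = P := by simpa using hP.eq
  rw [Matrix.IsHermitian, conjTranspose_eq_transpose_of_trivial]
  simp [transpose_mul, hPT, Matrix.mul_assoc, transpose_vecMulVec]

/-- A positive semidefinite `P` which solves a slightly amplified Riccati equation without state
cost, for an input weight that is close to the square of the product of the unstable
eigenvalues. -/
theorem exists_amplified_riccati {A : Matrix (Fin p) (Fin p) ℝ} {B : Fin p → ℝ} {η : ℝ}
    (hstab : Stabilizable A B) (hrho : 1 ≤ rho A) (hη : 0 ≤ η) (hηA : η < (unstableProd A)⁻¹) :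
    ∃ (s : ℝ) (P F : Matrix (Fin p) (Fin p) ℝ) (κ : Fin p → ℝ), 1 < s ∧ P.PosSemidef ∧
      rho F < 1 ∧ 0 < B ⬝ᵥ (P *ᵥ B) ∧ η ^ 2 * (1 + B ⬝ᵥ (P *ᵥ B)) ≤ 1 ∧
      (∀ x, F *ᵥ x = s • (A *ᵥ x) - (κ ⬝ᵥ x) • B) ∧
      (∀ x, (1 + B ⬝ᵥ (P *ᵥ B)) * (κ ⬝ᵥ x) = s * (B ⬝ᵥ (P *ᵥ (A *ᵥ x)))) ∧
      ∀ x, x ⬝ᵥ (P *ᵥ x) = s ^ 2 * ((A *ᵥ x) ⬝ᵥ (P *ᵥ (A *ᵥ x)))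
        - (κ ⬝ᵥ x) * (s * (B ⬝ᵥ (P *ᵥ (A *ᵥ x)))) := by
  have hp : NeZero p := pos_of_one_le_rho hrho
  have hϖ := one_le_unstableProd A
  have hηϖ : η * expandingProd (toComplex A).charpoly.roots < 1 := by
    calc η * unstableProd A < (unstableProd A)⁻¹ * unstableProd A := by gcongr
      _ = 1 := inv_mul_cancel₀ (by positivity)
  obtain ⟨s, hs1, hsc, hsη⟩ := exists_expanding_factor _ hη hηϖ
  have hs0 : 0 < s := zero_lt_one.trans hs1
  have hsC : (s : ℂ) ≠ 0 := by exact_mod_cast hs0.ne'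
  have hnorm : ∀ z : ℂ, ‖(s : ℂ) * z‖ = s * ‖z‖ := fun z => by
    rw [norm_mul, Complex.norm_real, Real.norm_of_nonneg hs0.le]
  have hcs : toComplex (s • A) = (s : ℂ) • toComplex A := by ext i j; simp [toComplex]
  have hroots := charpoly_roots_smul (toComplex A) hsC
  rw [← hcs] at hroots
  obtain ⟨P, k, hP, hfb, hric, hst, hb⟩ := exists_real_stabilizing (s • A) (replicateCol Unit B)
    (fun z hz => by
      rw [hroots] at hz
      obtain ⟨y, hy, rfl⟩ := Multiset.mem_map.1 hz
      rw [hnorm]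
      by_cases h : ‖y‖ < 1
      · exact (hsc y hy h).ne
      · push Not at h
        nlinarith)
    -- Such a `w` would be a left eigenvector of the stable `A + B F` for `z / s`. Thus `z / s` is
    -- an eigenvalue of `A` inside the disc, and by the choice of `s` so is `z`.
    (fun w z hw hz hwA hwB => by
      set v : Fin p → ℂ := w () with hv
      have hv0 : v ≠ 0 := fun h => hw (by ext i j; exact congrFun h j)
      have hvA : v ᵥ* toComplex (s • A) = z • v := by
        ext j; exact congrFun (congrFun hwA ()) j
      have hvA' : v ᵥ* toComplex A = (z / s) • v := by
        rw [hcs, Matrix.vecMul_smul] at hvA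
        rw [div_eq_inv_mul, mul_smul, ← hvA, smul_smul, inv_mul_cancel₀ hsC, one_smul]
      have hvB : v ⬝ᵥ (fun i => (B i : ℂ)) = 0 := by
        simpa [Matrix.mul_apply, dotProduct] using congrFun (congrFun hwB ()) ()
      obtain ⟨F, hF⟩ := hstab
      have hvF : v ᵥ* toComplex (A + vecMulVec B F) = (z / s) • v := by
        have : toComplex (A + vecMulVec B F) = toComplex A
            + vecMulVec (fun i => (B i : ℂ)) (fun i => (F i : ℂ)) := by
          ext i j; simp [toComplex, vecMulVec_apply]
        rw [this, Matrix.vecMul_add, Matrix.vecMul_vecMulVec, hvB, hvA']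
        simp
      have h1 := norm_le_spectralRadius_toReal (mem_spectrum_of_vecMul_eq_smul hv0 hvF)
      have h2 : z / s ∈ (toComplex A).charpoly.roots :=
        mem_spectrum_iff_mem_roots.1 (mem_spectrum_of_vecMul_eq_smul hv0 hvA')
      have h3 := hsc _ h2 (h1.trans_lt hF)
      rw [← hnorm, mul_div_cancel₀ _ hsC] at h3
      exact absurd hz (not_le.2 h3))
  set ϖ := unstableProd (s • A) with hϖs
  have hϖη : η * ϖ < 1 := by
    rw [hϖs]
    change η * expandingProd _ < 1
    rwa [hroots]
  -- Amplification pushes an eigenvalue of modulus at least one strictly outside the circle; this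
  -- gives `b > 0`.
  have hϖ1 : 1 < ϖ := by
    obtain ⟨z, hz, he⟩ := exists_norm_eq_spectralRadius_toReal (toComplex A)
    have h1 : 1 ≤ ‖z‖ := he ▸ hrho
    have h2 : 1 < ‖(s : ℂ) * z‖ := by rw [hnorm]; nlinarith
    refine h2.trans_le (le_expandingProd ?_ h2.le)
    rw [hroots]
    exact Multiset.mem_map_of_mem _ (mem_spectrum_iff_mem_roots.1 hz)
  set b := B ⬝ᵥ (P *ᵥ B) with hbdef
  have hb' : b = ϖ ^ 2 - 1 := by
    have := congrFun (congrFun hb ()) ()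
    rw [Matrix.mul_assoc] at this
    rw [hbdef]
    simpa [Matrix.mul_apply, dotProduct, Matrix.mulVec] using this
  have hb0 : 0 < b := by rw [hb']; nlinarith
  set F := s • A - replicateCol Unit B * k with hF
  set κ : Fin p → ℝ := k () with hκ
  have hFx : ∀ x, F *ᵥ x = s • (A *ᵥ x) - (κ ⬝ᵥ x) • B := fun x => by
    rw [hF, Matrix.sub_mulVec, Matrix.smul_mulVec]
    congr 1
    ext i
    simp only [Matrix.mulVec, dotProduct, Matrix.mul_apply, Finset.univ_unique, Finset.sum_singleton,
      replicateCol_apply, Pi.smul_apply, smul_eq_mul, Finset.sum_mul, hκ]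
    exact Finset.sum_congr rfl fun j _ => by change B i * k () j * x j = k () j * x j * B i; ring
  have hPs := hP.isHermitian
  have hfbx : ∀ x, κ ⬝ᵥ x = B ⬝ᵥ (P *ᵥ (F *ᵥ x)) := fun x => by
    have h1 : κ = B ᵥ* (P * F) := by
      ext j
      have := congrFun (congrFun hfb ()) j
      rw [Matrix.mul_assoc] at this
      rw [hκ, ← this]
      rfl
    rw [h1, ← Matrix.dotProduct_mulVec, Matrix.mulVec_mulVec]
  have hgain : ∀ x, (1 + b) * (κ ⬝ᵥ x) = s * (B ⬝ᵥ (P *ᵥ (A *ᵥ x))) := fun x => by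
    have := hfbx x
    rw [hFx, Matrix.mulVec_sub, Matrix.mulVec_smul, Matrix.mulVec_smul, dotProduct_sub,
      dotProduct_smul, dotProduct_smul, smul_eq_mul, smul_eq_mul, ← hbdef] at this
    linarith
  have hricx : ∀ x, x ⬝ᵥ (P *ᵥ x) = s ^ 2 * ((A *ᵥ x) ⬝ᵥ (P *ᵥ (A *ᵥ x)))
      - (κ ⬝ᵥ x) * (s * (B ⬝ᵥ (P *ᵥ (A *ᵥ x)))) := fun x => by
    conv_lhs => rw [hric]
    rw [← Matrix.mulVec_mulVec, ← Matrix.mulVec_mulVec, Matrix.dotProduct_mulVec,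
      Matrix.vecMul_transpose, hFx, Matrix.mulVec_sub, Matrix.mulVec_smul, Matrix.mulVec_smul,
      Matrix.smul_mulVec, dotProduct_sub, dotProduct_smul, dotProduct_smul, smul_dotProduct,
      smul_dotProduct, dotProduct_mulVec_symm hPs (A *ᵥ x) B]
    simp only [smul_eq_mul]
    ring
  refine ⟨s, P, F, κ, hs1, hP, hst, hb0, ?_, hFx, hgain, hricx⟩
  rw [← hbdef, hb']
  nlinarith [mul_nonneg hη (by linarith : (0 : ℝ) ≤ ϖ)]

/-- A lower bound, affine in `δ`, for the Riccati form of `P + δ X`. Unprimed letters belong to `P`,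
primed ones and `β` to `X`. The quotient `w ^ 2 / d` is bounded below by its tangent `2 τ w - τ ^ 2
d` at `τ = v / b`; the terms of `P` alone are handled by `1 / (1 + b) ≤ (1 - η ^ 2) / b`. -/
theorem riccati_slack {s η b v v' β a a' q q' δ κ : ℝ} (hs : 1 < s) (hη : η ^ 2 * (1 + b) ≤ 1)
    (hb0 : 0 < b) (hβ : 0 ≤ β) (hδ : 0 < δ) (h1 : a = s ^ 2 * q - κ * (s * v))
    (h2 : (1 + b) * κ = s * v) :
    (1 - (s ^ 2)⁻¹) * a + δ * (a' - q' + (1 - η ^ 2) * (2 * (v / b) * v' - β * (v / b) ^ 2))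
      ≤ a + δ * a' - (q + δ * q') + (1 - η ^ 2) / (b + δ * β) * (v + δ * v') ^ 2 := by
  have hs0 : 0 < s := zero_lt_one.trans hs
  have hηsq : 0 ≤ 1 - η ^ 2 := by nlinarith [sq_nonneg η]
  have hbδ : 0 < b + δ * β := by positivity
  have hκ' : κ = s * v / (1 + b) := by field_simp; linarith
  have hqa : q = (s ^ 2)⁻¹ * a + v ^ 2 / (1 + b) := by
    rw [h1, hκ']; field_simp; ring
  have hquot : 2 * (v / b) * (v + δ * v') - (v / b) ^ 2 * (b + δ * β)
      ≤ (v + δ * v') ^ 2 / (b + δ * β) := by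
    rw [le_div_iff₀ hbδ]
    nlinarith [sq_nonneg ((v + δ * v') - (v / b) * (b + δ * β))]
  have hbig : v ^ 2 / (1 + b) ≤ (1 - η ^ 2) * (v ^ 2 / b) := by
    have h3 : 1 / (1 + b) ≤ (1 - η ^ 2) / b := by
      rw [div_le_div_iff₀ (by positivity) hb0]
      linarith
    calc v ^ 2 / (1 + b) = v ^ 2 * (1 / (1 + b)) := by ring
      _ ≤ v ^ 2 * ((1 - η ^ 2) / b) := by gcongr
      _ = _ := by ring
  have hexp : 2 * (v / b) * (v + δ * v') - (v / b) ^ 2 * (b + δ * β)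
      = v ^ 2 / b + δ * (2 * (v / b) * v' - β * (v / b) ^ 2) := by
    field_simp; ring
  rw [hexp] at hquot
  have hquot' := mul_le_mul_of_nonneg_left hquot hηsq
  have hcomm : (1 - η ^ 2) / (b + δ * β) * (v + δ * v') ^ 2
      = (1 - η ^ 2) * ((v + δ * v') ^ 2 / (b + δ * β)) := by ring
  rw [hcomm, hqa]
  linarith

/-- The modified Riccati inequality is solvable when the product of the unstable eigenvalues is
smaller than the reciprocal of its parameter. -/
theorem exists_solvesRiccati {A : Matrix (Fin p) (Fin p) ℝ} {B : Fin p → ℝ} {η : ℝ}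
    (hstab : Stabilizable A B) (hrho : 1 ≤ rho A) (hη : 0 ≤ η) (hηA : η < (unstableProd A)⁻¹) :
    ∃ P, SolvesRiccati A B η P := by
  obtain ⟨s, P, F, κ, hs1, hP, hst, hb0, hηb, hFx, hgain, hricx⟩ :=
    exists_amplified_riccati hstab hrho hη hηA
  have hs0 : 0 < s := zero_lt_one.trans hs1
  have hPs := hP.isHermitian
  have hPnn : ∀ x, 0 ≤ x ⬝ᵥ (P *ᵥ x) := fun x => by
    simpa using hP.dotProduct_mulVec_nonneg x
  set b := B ⬝ᵥ (P *ᵥ B) with hbdef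
  obtain ⟨X, hX, hXF⟩ := exists_lyapunov F hst
  have hXnn : ∀ x, 0 ≤ x ⬝ᵥ (X *ᵥ x) := fun x => by
    simpa using hX.posSemidef.dotProduct_mulVec_nonneg x
  set f : (Fin p → ℝ) → ℝ := fun x => (1 - (s ^ 2)⁻¹) * (x ⬝ᵥ (P *ᵥ x)) with hf
  set g : (Fin p → ℝ) → ℝ := fun x => x ⬝ᵥ (X *ᵥ x) - (A *ᵥ x) ⬝ᵥ (X *ᵥ (A *ᵥ x))
    + (1 - η ^ 2) * (2 * (B ⬝ᵥ (P *ᵥ (A *ᵥ x)) / b) * (B ⬝ᵥ (X *ᵥ (A *ᵥ x)))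
      - (B ⬝ᵥ (X *ᵥ B)) * (B ⬝ᵥ (P *ᵥ (A *ᵥ x)) / b) ^ 2) with hg
  have hs2 : 0 < 1 - (s ^ 2)⁻¹ := by
    rw [sub_pos]; exact inv_lt_one_of_one_lt₀ (one_lt_pow₀ hs1 two_ne_zero)
  -- the zeros of the form of `P`
  have hzero : ∀ x, x ⬝ᵥ (P *ᵥ x) = 0 → B ⬝ᵥ (P *ᵥ (A *ᵥ x)) = 0 := fun x hx => by
    have h1 := hricx x
    have h2 := hgain x
    set v := B ⬝ᵥ (P *ᵥ (A *ᵥ x))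
    set q := (A *ᵥ x) ⬝ᵥ (P *ᵥ (A *ᵥ x))
    -- Cauchy–Schwarz for the form of `P`. Against `(1 + b) * q = v ^ 2`, obtained below from the
    -- Riccati equation, it leaves only `q = 0` and `v = 0`.
    have hcs : v ^ 2 ≤ b * q := by
      have h3 := hPnn (b • (A *ᵥ x) - v • B)
      simp only [Matrix.mulVec_sub, Matrix.mulVec_smul, dotProduct_sub, sub_dotProduct,
        smul_dotProduct, dotProduct_smul, smul_eq_mul,
        dotProduct_mulVec_symm hPs (A *ᵥ x) B] at h3
      change 0 ≤ b * (b * q - v * v) - v * (b * v - v * b) at h3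
      nlinarith
    have h4 : (1 + b) * (s ^ 2 * q) = s ^ 2 * v ^ 2 := by
      rw [hx] at h1
      have : (κ ⬝ᵥ x) * (s * v) = s ^ 2 * q := by linarith
      rw [← this]
      calc (1 + b) * (κ ⬝ᵥ x * (s * v)) = ((1 + b) * (κ ⬝ᵥ x)) * (s * v) := by ring
        _ = _ := by rw [h2]; ring
    have h5 : (1 + b) * q = v ^ 2 := by
      have hs2 : s ^ 2 ≠ 0 := by positivity
      exact mul_left_cancel₀ hs2 (by linarith)
    have h6 : 0 ≤ q := hPnn _
    have : v ^ 2 ≤ 0 := by nlinarith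
    exact pow_eq_zero_iff two_ne_zero |>.1 (le_antisymm this (sq_nonneg v))
  obtain ⟨δ, hδ, hpos⟩ := exists_pos_add_mul_pos (isCompact_sphere (0 : Fin p → ℝ) 1)
    (f := f) (g := g) (by fun_prop) (by fun_prop)
    (fun x _ => mul_nonneg hs2.le (hPnn x)) (fun x hx hfx => by
      have hx0 : x ≠ 0 := by
        rintro rfl
        simp at hx
      have hPx : x ⬝ᵥ (P *ᵥ x) = 0 := (mul_eq_zero.1 hfx).resolve_left hs2.ne'
      have hv := hzero x hPx
      -- On the kernel of `P` the feedback vanishes, so `F *ᵥ x = s • (A *ᵥ x)` and the Lyapunov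
      -- decrease of `X` along `F` applies to `A` itself, as `s > 1`.
      have hκx : κ ⬝ᵥ x = 0 := by
        have := hgain x
        rw [hv, mul_zero] at this
        exact (mul_eq_zero.1 this).resolve_left (by positivity)
      have h1 := hXF x hx0
      rw [hFx, hκx, zero_smul, sub_zero, Matrix.mulVec_smul, smul_dotProduct, dotProduct_smul,
        smul_eq_mul, smul_eq_mul] at h1
      have h2 := hXnn (A *ᵥ x)
      simp only [hg, hv]
      have : 1 ≤ s ^ 2 := one_le_pow₀ hs1.le
      have h3 : (A *ᵥ x) ⬝ᵥ (X *ᵥ (A *ᵥ x)) ≤ s * (s * ((A *ᵥ x) ⬝ᵥ (X *ᵥ (A *ᵥ x)))) := by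
        nlinarith
      simp only [zero_div, mul_zero, zero_mul, sub_zero, add_zero, zero_pow two_ne_zero]
      linarith)
  have hQ : (P + δ • X).PosDef := Matrix.PosDef.posSemidef_add hP (hX.smul hδ)
  have hmain : ∀ x, x ≠ 0 → 0 < f x + δ * g x := fun x hx => by
    have hx0 : 0 < ‖x‖ := norm_pos_iff.2 hx
    have h1 := hpos (‖x‖⁻¹ • x) (by simp [norm_smul, hx0.ne'])
    have h2 : f (‖x‖⁻¹ • x) + δ * g (‖x‖⁻¹ • x) = (‖x‖⁻¹) ^ 2 * (f x + δ * g x) := by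
      simp only [hf, hg, Matrix.mulVec_smul, smul_dotProduct, dotProduct_smul, smul_eq_mul]
      ring
    rw [h2] at h1
    exact (mul_pos_iff_of_pos_left (by positivity)).1 h1
  refine ⟨P + δ • X, hQ, Matrix.PosDef.of_dotProduct_mulVec_pos
    (isHermitian_riccati _ _ hQ.isHermitian _ _) fun x hx => ?_⟩
  rw [star_trivial, riccati_form _ _ hQ.isHermitian]
  refine (hmain x hx).trans_le ?_
  have hslack := riccati_slack (a' := x ⬝ᵥ (X *ᵥ x)) (q' := (A *ᵥ x) ⬝ᵥ (X *ᵥ (A *ᵥ x)))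
    (v' := B ⬝ᵥ (X *ᵥ (A *ᵥ x))) hs1 hηb hb0 (hXnn B) hδ (hricx x) (hgain x)
  simpa only [Matrix.add_mulVec, Matrix.smul_mulVec, dotProduct_add, dotProduct_smul, smul_eq_mul]
    using hslack

end RiccatiInequality

end MultiAgent

/-! ### Spectrum of the Laplacian of a connected graph -/

namespace WeightedGraph

variable {N : ℕ}

theorem weight_self (G : WeightedGraph N) (i : Fin N) : G.weight i i = 0 :=
  G.weight_zero i i (G.graph.loopless.irrefl i)

theorem weight_nonneg (G : WeightedGraph N) (i j : Fin N) : 0 ≤ G.weight i j := by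
  by_cases h : G.graph.Adj i j
  · exact (G.weight_pos i j h).le
  · exact (G.weight_zero i j h).ge

theorem laplacian_mulVec (G : WeightedGraph N) (x : Fin N → ℝ) (i : Fin N) :
    (G.laplacian *ᵥ x) i = ∑ j, G.weight i j * (x i - x j) := by
  have h : ∀ j, G.laplacian i j * x j
      = (if i = j then (∑ k, G.weight i k) * x j else 0) - G.weight i j * x j := fun j => by
    by_cases hij : i = j
    · subst hij
      simp [laplacian, G.weight_self]
    · simp [laplacian, hij]
  simp only [Matrix.mulVec, dotProduct, h, Finset.sum_sub_distrib, mul_sub, Finset.sum_ite_eq,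
    Finset.mem_univ, if_true, Finset.sum_mul]

/-- The Laplacian form is half the weighted sum of the squared differences. -/
theorem two_mul_dotProduct_laplacian (G : WeightedGraph N) (x : Fin N → ℝ) :
    2 * (x ⬝ᵥ (G.laplacian *ᵥ x)) = ∑ i, ∑ j, G.weight i j * (x i - x j) ^ 2 := by
  have h1 : x ⬝ᵥ (G.laplacian *ᵥ x) = ∑ i, ∑ j, x i * (G.weight i j * (x i - x j)) := by
    simp only [dotProduct, laplacian_mulVec, Finset.mul_sum]
  have h2 : x ⬝ᵥ (G.laplacian *ᵥ x) = ∑ i, ∑ j, x j * (G.weight i j * (x j - x i)) := by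
    rw [h1, Finset.sum_comm]
    exact Finset.sum_congr rfl fun i _ => Finset.sum_congr rfl fun j _ => by
      rw [G.weight_symm i j]
  rw [two_mul]
  nth_rewrite 1 [h1]
  rw [h2, ← Finset.sum_add_distrib]
  refine Finset.sum_congr rfl fun i _ => ?_
  rw [← Finset.sum_add_distrib]
  exact Finset.sum_congr rfl fun j _ => by ring

theorem dotProduct_laplacian_nonneg (G : WeightedGraph N) (x : Fin N → ℝ) :
    0 ≤ x ⬝ᵥ (G.laplacian *ᵥ x) := by
  have h : 0 ≤ ∑ i, ∑ j, G.weight i j * (x i - x j) ^ 2 :=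
    Finset.sum_nonneg fun i _ => Finset.sum_nonneg fun j _ =>
      mul_nonneg (G.weight_nonneg i j) (sq_nonneg _)
  linarith [G.two_mul_dotProduct_laplacian x]

theorem eq_of_laplacian_mulVec_eq_zero (G : WeightedGraph N) (hG : G.graph.Connected)
    {x : Fin N → ℝ} (hx : G.laplacian *ᵥ x = 0) (i j : Fin N) : x i = x j := by
  have h := G.two_mul_dotProduct_laplacian x
  rw [hx, dotProduct_zero, mul_zero] at h
  have hadj : ∀ i j, G.graph.Adj i j → x i = x j := fun i j hij => by
    have h1 := (Finset.sum_eq_zero_iff_of_nonneg fun i _ => Finset.sum_nonneg fun j _ =>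
      mul_nonneg (G.weight_nonneg i j) (sq_nonneg (x i - x j))).1 h.symm i (Finset.mem_univ i)
    have h2 := (Finset.sum_eq_zero_iff_of_nonneg fun j _ =>
      mul_nonneg (G.weight_nonneg i j) (sq_nonneg (x i - x j))).1 h1 j (Finset.mem_univ j)
    have h3 := (mul_eq_zero.1 h2).resolve_left (G.weight_pos i j hij).ne'
    exact sub_eq_zero.1 (pow_eq_zero_iff two_ne_zero |>.1 h3)
  obtain ⟨w⟩ := hG.preconnected i j
  induction w with
  | nil => rfl
  | cons hab _ ih => exact (hadj _ _ hab).trans ih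

/-- An orthonormal eigenbasis of the Laplacian of a connected graph: one constant eigenvector with
eigenvalue zero, all other eigenvalues between the second smallest and the largest one. -/
theorem exists_laplacian_eigenbasis (hN : 2 ≤ N) (G : WeightedGraph N) (hG : G.graph.Connected)
    (h1N : 1 < N) (hlast : N - 1 < N) :
    ∃ (U : Fin N → Fin N → ℝ) (l : Fin N → ℝ) (k₀ : Fin N) (c : ℝ),
      (∀ i j, ∑ k, U k i * U k j = if i = j then 1 else 0) ∧
      (∀ k, G.laplacian *ᵥ U k = l k • U k) ∧ (∀ i, U k₀ i = c) ∧ N * (c * c) = 1 ∧ l k₀ = 0 ∧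
      (∀ k, k ≠ k₀ → G.eigenvalue ⟨1, h1N⟩ ≤ l k ∧ l k ≤ G.eigenvalue ⟨N - 1, hlast⟩) ∧
      0 < G.eigenvalue ⟨1, h1N⟩ ∧
      G.eigenvalue ⟨1, h1N⟩ ≤ G.eigenvalue ⟨N - 1, hlast⟩ := by
  set hH := G.laplacian_isHermitian
  set b := hH.eigenvectorBasis with hb
  set U : Fin N → Fin N → ℝ := fun k => ⇑(b k) with hU
  have hrow : ∀ k l, ∑ i, U k i * U l i = if k = l then 1 else 0 := fun k l => by
    have := orthonormal_iff_ite.1 b.orthonormal k l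
    rw [PiLp.inner_apply] at this
    simpa [mul_comm, U] using this
  have hcol : ∀ i j, ∑ k, U k i * U k j = if i = j then 1 else 0 := fun i j => by
    have h1 : (Matrix.of U) * (Matrix.of U)ᵀ = 1 := by
      ext k l
      simp [Matrix.mul_apply, hrow, Matrix.one_apply]
    have h2 : ((Matrix.of U)ᵀ * Matrix.of U) i j = (1 : Matrix _ _ ℝ) i j := by
      rw [mul_eq_one_comm.1 h1]
    simpa [Matrix.mul_apply, Matrix.one_apply] using h2
  have heig : ∀ k, G.laplacian *ᵥ U k = hH.eigenvalues k • U k := fun k =>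
    hH.mulVec_eigenvectorBasis k
  have hnn : ∀ k, 0 ≤ hH.eigenvalues k := fun k => by
    have h1 := G.dotProduct_laplacian_nonneg (U k)
    have h2 : U k ⬝ᵥ U k = 1 := by simpa [dotProduct] using hrow k k
    rwa [heig, dotProduct_smul, h2, smul_eq_mul, mul_one] at h1
  set e : Fin (Fintype.card (Fin N)) ≃ Fin N := Fintype.equivOfCardEq (Fintype.card_fin _) with he
  have hval : ∀ k, hH.eigenvalues k = hH.eigenvalues₀ (e.symm k) := fun k => rfl
  -- The kernel consists of constant vectors, and two constant unit vectors are never orthogonal.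
  have hzero : ∀ k l, hH.eigenvalues k = 0 → hH.eigenvalues l = 0 → k = l := fun k l hk hl => by
    by_contra hkl
    have h1 : ∀ m, hH.eigenvalues m = 0 → ∀ i j, U m i = U m j := fun m hm =>
      G.eq_of_laplacian_mulVec_eq_zero hG (by rw [heig, hm, zero_smul])
    have i : Fin N := k
    have h2 : ∀ m m', hH.eigenvalues m = 0 → hH.eigenvalues m' = 0 →
        ∑ j, U m j * U m' j = N * (U m i * U m' i) := fun m m' hm hm' => by
      rw [Finset.sum_congr rfl fun j _ => by rw [h1 m hm j i, h1 m' hm' j i]]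
      simp
    have h3 := (h2 k l hk hl).symm.trans (hrow k l)
    have h4 := (h2 k k hk hk).symm.trans (hrow k k)
    have h5 := (h2 l l hl hl).symm.trans (hrow l l)
    rw [if_neg hkl] at h3
    rw [if_pos rfl] at h4 h5
    have hN0 : (N : ℝ) ≠ 0 := by positivity
    rcases mul_eq_zero.1 ((mul_eq_zero.1 h3).resolve_left hN0) with h | h
    · rw [h] at h4; simp at h4
    · rw [h] at h5; simp at h5
  -- Otherwise the constant vector, which lies in the kernel, would be orthogonal to the whole
  -- eigenbasis.
  have hex : ∃ k, hH.eigenvalues k = 0 := by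
    by_contra! hne
    have hL1 : G.laplacian *ᵥ (fun _ => (1 : ℝ)) = 0 := by
      ext i; simp [laplacian_mulVec]
    have hdot : ∀ k, ∑ i, U k i = 0 := fun k => by
      have h1 : U k ⬝ᵥ (G.laplacian *ᵥ fun _ => (1 : ℝ)) = 0 := by rw [hL1, dotProduct_zero]
      have hT : G.laplacianᵀ = G.laplacian := by simpa using hH.eq
      rw [Matrix.dotProduct_mulVec, ← Matrix.mulVec_transpose, hT, heig, smul_dotProduct,
        smul_eq_mul] at h1
      simpa [dotProduct] using (mul_eq_zero.1 h1).resolve_left (hne k)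
    have i : Fin N := ⟨0, by omega⟩
    have h1 : ∑ j, ∑ k, U k i * U k j = 1 := by simp [hcol]
    rw [Finset.sum_comm] at h1
    simp [← Finset.mul_sum, hdot] at h1
  have hcard : Fintype.card (Fin N) = N := Fintype.card_fin N
  -- `eigenvalues₀` is nonincreasing: the zero eigenvalue sits at index `N - 1`, the second smallest
  -- at `N - 2`, the largest at `0`.
  set k₀ : Fin N := e ⟨N - 1, by omega⟩ with hk₀
  have hanti := hH.eigenvalues₀_antitone
  have hk₀0 : hH.eigenvalues k₀ = 0 := by
    obtain ⟨k, hk⟩ := hex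
    refine le_antisymm ?_ (hnn k₀)
    rw [← hk, hval, hval, hk₀, Equiv.symm_apply_apply]
    exact hanti (Fin.le_def.2 (by have := (e.symm k).2; simp only; omega))
  have h2 : G.eigenvalue ⟨1, h1N⟩ = hH.eigenvalues₀ ⟨N - 2, by omega⟩ := by
    unfold eigenvalue
    congr 1
  have hN1 : G.eigenvalue ⟨N - 1, hlast⟩ = hH.eigenvalues₀ ⟨0, by omega⟩ := by
    unfold eigenvalue
    congr 1
    ext
    simp [Fin.val_rev]
    omega
  have hpos : ∀ k, k ≠ k₀ → 0 < hH.eigenvalues k := fun k hk =>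
    lt_of_le_of_ne (hnn k) fun h => hk (hzero k k₀ h.symm hk₀0)
  have hconst : ∀ i, U k₀ i = U k₀ k₀ := fun i =>
    G.eq_of_laplacian_mulVec_eq_zero hG (by rw [heig, hk₀0, zero_smul]) i k₀
  refine ⟨U, hH.eigenvalues, k₀, U k₀ k₀, hcol, heig, hconst, ?_, hk₀0, fun k hk => ?_, ?_, ?_⟩
  · have := hrow k₀ k₀
    rw [if_pos rfl, Finset.sum_congr rfl fun i _ => by rw [hconst i]] at this
    simpa using this
  · rw [h2, hN1, hval]
    have hne : (e.symm k : ℕ) ≠ N - 1 := fun h => hk <| by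
      rw [hk₀, ← e.symm_apply_eq]
      exact Fin.ext h
    refine ⟨hanti (Fin.le_def.2 ?_), hanti (Fin.le_def.2 (Nat.zero_le _))⟩
    have := (e.symm k).2
    simp only
    omega
  · rw [h2]
    have h3 := hpos (e ⟨N - 2, by omega⟩) fun h => by
      have := Fin.mk.inj (e.injective h)
      omega
    rwa [hval, Equiv.symm_apply_apply] at h3
  · rw [h2, hN1]
    exact hanti (Fin.le_def.2 (Nat.zero_le _))

end WeightedGraph

/-! ### Decay of the modes and synchronization -/

namespace MultiAgent

section Synchronization

attribute [local instance] Matrix.linftyOpNormedRing Matrix.linftyOpNormedAlgebra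

variable {N p : ℕ}

/-- A contracting sequence coupled to a possibly growing one through a coupling that decays faster
than the latter grows tends to zero. -/
theorem tendsto_zero_of_decaying_coupling {e x : ℕ → ℝ} {q μ r C : ℝ} (he : ∀ t, 0 ≤ e t)
    (hx : ∀ t, 0 ≤ x t) (hq1 : q < 1) (hr : 0 < r) (hr1 : r < 1)
    (hrμ : r * μ < 1) (hC : 0 ≤ C)
    (hes : ∀ t, e (t + 1) ≤ q * e t + C * r ^ t * (e t + x t))
    (hxs : ∀ t, x (t + 1) ≤ μ * x t + C * r ^ t * (e t + x t)) : Tendsto e atTop (𝓝 0) := by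
  obtain ⟨θ, hθ, hθ1⟩ := exists_between (max_lt (max_lt hq1 hrμ) one_pos)
  have hqθ : q < θ := (le_max_left _ _).trans_lt ((le_max_left _ _).trans_lt hθ)
  have hμθ : r * μ < θ := (le_max_right _ _).trans_lt ((le_max_left _ _).trans_lt hθ)
  have hθ0 : 0 < θ := (le_max_right _ _).trans_lt hθ
  have hd : 0 < θ - r * μ := sub_pos.2 hμθ
  -- In the weighted sum `e t + M * r ^ t * x t` the second term shrinks at rate `r * μ < θ` on its
  -- own. Half of the gap `θ - r * μ`, times `M`, absorbs the coupling `C` into `e`; the other half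
  -- absorbs the perturbation of `x` for large `t`.
  set M := 2 * C / (θ - r * μ) with hM
  have hM0 : 0 ≤ M := by positivity
  have hMC : M * (θ - r * μ) = 2 * C := div_mul_cancel₀ _ hd.ne'
  have hpow := tendsto_pow_atTop_nhds_zero_of_lt_one hr.le hr1
  have ev1 : ∀ᶠ t : ℕ in atTop, (C + M * r * C) * r ^ t < θ - q :=
    (hpow.const_mul _).eventually_lt_const (by simpa using hqθ)
  have ev2 : ∀ᶠ t : ℕ in atTop, r * C * r ^ t < (θ - r * μ) / 2 :=
    (hpow.const_mul _).eventually_lt_const (by rw [mul_zero]; positivity)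
  obtain ⟨T, hT⟩ := eventually_atTop.1 (ev1.and ev2)
  set w : ℕ → ℝ := fun t => e t + M * r ^ t * x t with hw
  have hstep : ∀ t, T ≤ t → w (t + 1) ≤ θ * w t := fun t ht => by
    obtain ⟨h1, h2⟩ := hT t ht
    have hrt : 0 < r ^ t := by positivity
    have hrt1 : r ^ t ≤ 1 := pow_le_one₀ hr.le hr1.le
    have hMr : 0 ≤ M * r ^ (t + 1) := by positivity
    have h3 := mul_le_mul_of_nonneg_left (hxs t) hMr
    have h4 : q + C * r ^ t + M * r ^ (t + 1) * (C * r ^ t) ≤ θ := by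
      have : M * r ^ (t + 1) * (C * r ^ t) ≤ M * r * C * r ^ t := by
        calc M * r ^ (t + 1) * (C * r ^ t) = (M * r * C * r ^ t) * r ^ t := by ring
          _ ≤ (M * r * C * r ^ t) * 1 := by gcongr
          _ = _ := mul_one _
      linarith
    have h5 : C * r ^ t + M * r ^ (t + 1) * (μ + C * r ^ t) ≤ θ * (M * r ^ t) := by
      have h6 : C + M * (r * μ) + M * (r * C * r ^ t) ≤ θ * M := by
        have := mul_le_mul_of_nonneg_left h2.le hM0
        linarith
      calc C * r ^ t + M * r ^ (t + 1) * (μ + C * r ^ t)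
          = r ^ t * (C + M * (r * μ) + M * (r * C * r ^ t)) := by ring
        _ ≤ r ^ t * (θ * M) := by gcongr
        _ = _ := by ring
    have h7 := mul_le_mul_of_nonneg_right h4 (he t)
    have h8 := mul_le_mul_of_nonneg_right h5 (hx t)
    have h9 := hes t
    simp only [hw]
    linarith
  have hgeo : ∀ k, w (k + T) ≤ θ ^ k * w T := fun k => by
    induction k with
    | zero => simp
    | succ k ih =>
      rw [show k + 1 + T = k + T + 1 by omega]
      calc w (k + T + 1) ≤ θ * w (k + T) := hstep _ (Nat.le_add_left _ _)
        _ ≤ θ * (θ ^ k * w T) := by gcongr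
        _ = _ := by ring
  refine (tendsto_add_atTop_iff_nat T).1 (squeeze_zero (fun k => he _)
    (fun k => le_trans ?_ (hgeo k)) ?_)
  · have : 0 ≤ M * r ^ (k + T) * x (k + T) := mul_nonneg (by positivity) (hx _)
    simp only [hw]
    linarith
  · simpa using (tendsto_pow_atTop_nhds_zero_of_lt_one hθ0.le hθ1).mul_const (w T)

/-- Linear modes, all but one of them stable, under a perturbation that decays faster than the
remaining mode grows: the stable ones tend to zero. -/
theorem tendsto_zero_of_perturbed_modes {ι : Type*} [Fintype ι] [DecidableEq ι]
    {y : ℕ → ι → Fin p → ℝ}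
    {M : ι → Matrix (Fin p) (Fin p) ℝ} {k₀ : ι} {r C : ℝ} (hr : 0 < r) (hr1 : r < 1)
    (hC : 0 ≤ C) (hM : ∀ k, k ≠ k₀ → rho (M k) < 1) (hM₀ : r * rho (M k₀) < 1)
    (hy : ∀ t k, ‖y (t + 1) k - M k *ᵥ y t k‖ ≤ C * r ^ t * ∑ l, ‖y t l‖) {k : ι} (hk : k ≠ k₀) :
    Tendsto (fun t => y t k) atTop (𝓝 0) := by
  have hev : ∀ᶠ q in 𝓝[<] (1 : ℝ), ∀ k, k ≠ k₀ → rho (M k) < q := by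
    refine eventually_all.2 fun k => ?_
    by_cases hk : k = k₀
    · simp [hk]
    · have h := (eventually_gt_nhds (hM k hk)).filter_mono
        (nhdsWithin_le_nhds (s := Set.Iio (1 : ℝ)))
      exact h.mono fun q hq _ => hq
  obtain ⟨q, hMq, hq1⟩ := (hev.and self_mem_nhdsWithin).exists
  have hq0 : 0 ≤ q := ENNReal.toReal_nonneg.trans (hMq k hk).le
  obtain ⟨μ, hμ, hμr⟩ : ∃ μ, rho (M k₀) < μ ∧ μ < r⁻¹ :=
    exists_between (by rwa [← one_div, lt_div_iff₀' hr])
  have hrμ : r * μ < 1 := by rwa [← one_div, lt_div_iff₀' hr] at hμr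
  have hμ0 : 0 ≤ μ := ENNReal.toReal_nonneg.trans hμ.le
  -- Adapted norms give the rates `q` and `μ` in a single step, which reduces the system to two
  -- scalar sequences.
  have hν : ∀ k, ∃ (ν : (Fin p → ℝ) → ℝ) (D : ℝ), 0 ≤ D ∧ (∀ x, ‖x‖ ≤ ν x) ∧
      (∀ x, ν x ≤ D * ‖x‖) ∧ (∀ x y, ν (x + y) ≤ ν x + ν y) ∧
      ∀ x, ν (M k *ᵥ x) ≤ (if k = k₀ then μ else q) * ν x := fun k => by
    by_cases hk : k = k₀
    · subst hk; simpa using exists_adapted_norm _ hμ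
    · simpa [hk] using exists_adapted_norm _ (hMq k hk)
  choose ν D hD hle hge hadd hmul using hν
  have hν0 : ∀ k x, 0 ≤ ν k x := fun k x => (norm_nonneg x).trans (hle k x)
  set e : ℕ → ℝ := fun t => ∑ k ∈ Finset.univ.erase k₀, ν k (y t k) with he
  set x : ℕ → ℝ := fun t => ν k₀ (y t k₀) with hx
  have hsum : ∀ t, ∑ l, ‖y t l‖ ≤ e t + x t := fun t => by
    rw [he, hx]
    simp only
    rw [Finset.sum_erase_add _ _ (Finset.mem_univ k₀)]
    exact Finset.sum_le_sum fun l _ => hle l _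
  have hex0 : ∀ t, 0 ≤ e t + x t := fun t =>
    (Finset.sum_nonneg fun l _ => norm_nonneg _).trans (hsum t)
  have hstep : ∀ t k, ν k (y (t + 1) k) ≤ (if k = k₀ then μ else q) * ν k (y t k)
      + D k * (C * r ^ t * (e t + x t)) := fun t k => by
    have h1 : y (t + 1) k = M k *ᵥ y t k + (y (t + 1) k - M k *ᵥ y t k) := by abel
    rw [h1]
    refine (hadd k _ _).trans (add_le_add (hmul k _) ((hge k _).trans ?_))
    refine mul_le_mul_of_nonneg_left ((hy t k).trans ?_) (hD k)
    exact mul_le_mul_of_nonneg_left (hsum t) (by positivity)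
  have hDk₀ : D k₀ ≤ ∑ k, D k := Finset.single_le_sum (fun k _ => hD k) (Finset.mem_univ k₀)
  have hDk : ∑ k ∈ Finset.univ.erase k₀, D k ≤ ∑ k, D k :=
    Finset.sum_le_sum_of_subset_of_nonneg (Finset.erase_subset _ _) fun k _ _ => hD k
  have hlim : Tendsto e atTop (𝓝 0) := by
    refine tendsto_zero_of_decaying_coupling (x := x) (q := q) (μ := μ) (r := r)
      (C := (∑ k, D k) * C) (fun t => Finset.sum_nonneg fun k _ => hν0 k _) (fun t => hν0 k₀ _)
      hq1 hr hr1 hrμ (mul_nonneg (Finset.sum_nonneg fun k _ => hD k) hC) (fun t => ?_) fun t => ?_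
    · calc e (t + 1) ≤ ∑ k ∈ Finset.univ.erase k₀, (q * ν k (y t k)
            + D k * (C * r ^ t * (e t + x t))) := Finset.sum_le_sum fun k hk => by
            have := hstep t k
            rwa [if_neg (Finset.ne_of_mem_erase hk)] at this
        _ = q * e t + (∑ k ∈ Finset.univ.erase k₀, D k) * (C * r ^ t * (e t + x t)) := by
            rw [Finset.sum_add_distrib, ← Finset.mul_sum, ← Finset.sum_mul]
        _ ≤ q * e t + (∑ k, D k) * (C * r ^ t * (e t + x t)) := by
            have : 0 ≤ C * r ^ t * (e t + x t) := mul_nonneg (by positivity) (hex0 t)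
            gcongr
        _ = _ := by ring
    · have h1 := hstep t k₀
      rw [if_pos rfl] at h1
      calc x (t + 1) ≤ μ * x t + D k₀ * (C * r ^ t * (e t + x t)) := h1
        _ ≤ μ * x t + (∑ k, D k) * (C * r ^ t * (e t + x t)) := by
            have : 0 ≤ C * r ^ t * (e t + x t) := mul_nonneg (by positivity) (hex0 t)
            gcongr
        _ = _ := by ring
  refine squeeze_zero_norm (fun t => (hle k _).trans ?_) hlim
  exact Finset.single_le_sum (f := fun k => ν k (y t k)) (fun k _ => hν0 k _)
    (Finset.mem_erase.2 ⟨hk, Finset.mem_univ k⟩)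

section Modes

variable {E : Type*} [AddCommGroup E] [Module ℝ E]

/-- The diffusive coupling acts on the mode along an eigenvector of the Laplacian as
multiplication by the negative of the eigenvalue. -/
theorem sum_smul_coupling (G : WeightedGraph N) {u : Fin N → ℝ} {l : ℝ}
    (hu : G.laplacian *ᵥ u = l • u) (X : Fin N → E) :
    ∑ i, u i • ∑ j, G.weight i j • (X j - X i) = -(l • ∑ i, u i • X i) := by
  have h1 : ∑ i, ∑ j, (u i * G.weight i j) • X j = ∑ i, ∑ j, (u j * G.weight i j) • X i := by
    rw [Finset.sum_comm]
    exact Finset.sum_congr rfl fun i _ => Finset.sum_congr rfl fun j _ => by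
      rw [G.weight_symm]
  have h2 : ∀ i, l * u i = ∑ j, G.weight i j * (u i - u j) := fun i => by
    rw [← G.laplacian_mulVec, hu]; rfl
  simp only [Finset.smul_sum, smul_sub, smul_smul, Finset.sum_sub_distrib]
  rw [h1, ← Finset.sum_sub_distrib, ← Finset.sum_neg_distrib]
  refine Finset.sum_congr rfl fun i _ => ?_
  rw [← Finset.sum_sub_distrib, h2, Finset.sum_smul, ← Finset.sum_neg_distrib]
  refine Finset.sum_congr rfl fun j _ => ?_
  rw [← sub_smul, ← neg_smul]
  congr 1; ring

/-- The module `E` is general because both the states and the system matrices are expanded in modes.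
-/
theorem eq_sum_modes {U : Fin N → Fin N → ℝ}
    (hU : ∀ i j, ∑ k, U k i * U k j = if i = j then 1 else 0) (X : Fin N → E) (i : Fin N) :
    X i = ∑ k, U k i • ∑ j, U k j • X j := by
  simp only [Finset.smul_sum, smul_smul]
  rw [Finset.sum_comm]
  simp only [← Finset.sum_smul, hU, ite_smul, one_smul, zero_smul, Finset.sum_ite_eq,
    Finset.mem_univ, if_true]

end Modes

/-- The system matrices approach their average exponentially. -/
theorem exists_systemMatrix_bound (G : WeightedGraph N) {U : Fin N → Fin N → ℝ} {l : Fin N → ℝ}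
    {k₀ : Fin N} {u₀ c r : ℝ} (hU : ∀ i j, ∑ k, U k i * U k j = if i = j then 1 else 0)
    (hl : ∀ k, G.laplacian *ᵥ U k = l k • U k) (hu₀ : ∀ i, U k₀ i = u₀) (hN : N * (u₀ * u₀) = 1)
    (hl₀ : l k₀ = 0) (hr₀ : 0 ≤ r) (hr : ∀ k, k ≠ k₀ → |1 - c * l k| ≤ r)
    (S₀ : Fin N → Matrix (Fin p) (Fin p) ℝ) :
    ∃ C, 0 ≤ C ∧ ∀ t i, ‖systemMatrix G c S₀ t i - average S₀‖ ≤ C * r ^ t := by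
  have hmode : ∀ k t, ∑ i, U k i • systemMatrix G c S₀ t i
      = (1 - c * l k) ^ t • ∑ i, U k i • S₀ i := fun k t => by
    induction t with
    | zero => simp [systemMatrix]
    | succ t ih =>
      simp only [systemMatrix, smul_add, Finset.sum_add_distrib, smul_comm _ c]
      rw [← Finset.smul_sum, sum_smul_coupling G (hl k), ih, smul_neg, smul_smul, smul_smul,
        ← sub_eq_add_neg, ← sub_smul]
      congr 1; ring
  have havg : ∀ i, U k₀ i • ∑ j, U k₀ j • S₀ j = average S₀ := fun i => by
    have hN0 : (N : ℝ) ≠ 0 := fun h => by rw [h, zero_mul] at hN; exact zero_ne_one hN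
    simp only [hu₀, average]
    rw [← Finset.smul_sum, smul_smul]
    congr 1
    field_simp
    linarith
  refine ⟨∑ i, ∑ k, |U k i| * ‖∑ j, U k j • S₀ j‖, by positivity, fun t i => ?_⟩
  rw [eq_sum_modes hU (systemMatrix G c S₀ t) i, ← Finset.sum_erase_add _ _ (Finset.mem_univ k₀),
    hmode k₀, hl₀, mul_zero, sub_zero, one_pow, one_smul, havg, add_sub_cancel_right]
  calc ‖∑ k ∈ Finset.univ.erase k₀, U k i • ∑ j, U k j • systemMatrix G c S₀ t j‖
      ≤ ∑ k ∈ Finset.univ.erase k₀, |U k i| * ‖∑ j, U k j • S₀ j‖ * r ^ t := by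
        refine norm_sum_le_of_le _ fun k hk => ?_
        rw [hmode, norm_smul, norm_smul, norm_pow, Real.norm_eq_abs, Real.norm_eq_abs, mul_assoc,
          mul_comm (‖_‖) (r ^ t)]
        have := hr k (Finset.ne_of_mem_erase hk)
        gcongr
    _ ≤ ∑ k, |U k i| * ‖∑ j, U k j • S₀ j‖ * r ^ t :=
        Finset.sum_le_sum_of_subset_of_nonneg (Finset.erase_subset _ _) fun k _ _ => by positivity
    _ = (∑ k, |U k i| * ‖∑ j, U k j • S₀ j‖) * r ^ t := (Finset.sum_mul ..).symm
    _ ≤ _ := by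
        refine mul_le_mul_of_nonneg_right ?_ (by positivity)
        exact Finset.single_le_sum (f := fun i => ∑ k, |U k i| * ‖∑ j, U k j • S₀ j‖)
          (fun i _ => by positivity) (Finset.mem_univ i)

/-- Exhibits the feedback as `H * S` with `H` independent of the agent and of time, the form
required by `exists_mode_bound`. -/
theorem gain_dotProduct_smul (g : ℝ) (B : Fin p → ℝ) (P S : Matrix (Fin p) (Fin p) ℝ)
    (v : Fin p → ℝ) :
    (gain g B P S ⬝ᵥ v) • B = (((g / (B ⬝ᵥ (P *ᵥ B))) • (vecMulVec B B * P)) * S) *ᵥ v := by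
  rw [gain, smul_dotProduct, ← Matrix.dotProduct_mulVec, ← Matrix.mulVec_mulVec,
    ← Matrix.mulVec_mulVec, Matrix.smul_mulVec, ← Matrix.mulVec_mulVec, Matrix.vecMulVec_mulVec, smul_eq_mul, mul_smul,
    op_smul_eq_smul]

/-- For a feedback that is linear in the system matrix, the modes of the states follow the limiting
closed loop matrices up to a perturbation that decays with the system matrices. -/
theorem exists_mode_bound (G : WeightedGraph N) {U : Fin N → Fin N → ℝ} {l : Fin N → ℝ}
    (hU : ∀ i j, ∑ k, U k i * U k j = if i = j then 1 else 0)
    (hl : ∀ k, G.laplacian *ᵥ U k = l k • U k) {c r C : ℝ} (hr : 0 ≤ r) (hC : 0 ≤ C)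
    {S₀ : Fin N → Matrix (Fin p) (Fin p) ℝ} {S : Matrix (Fin p) (Fin p) ℝ}
    (hS : ∀ t i, ‖systemMatrix G c S₀ t i - S‖ ≤ C * r ^ t) {B : Fin p → ℝ}
    {K : Matrix (Fin p) (Fin p) ℝ → Fin p → ℝ} {H : Matrix (Fin p) (Fin p) ℝ}
    (hK : ∀ S v, (K S ⬝ᵥ v) • B = (H * S) *ᵥ v) (ξ₀ : Fin N → Fin p → ℝ) :
    ∃ D, 0 ≤ D ∧ ∀ t k, ‖∑ i, U k i • state G c B K S₀ ξ₀ (t + 1) i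
        - (S - l k • (H * S)) *ᵥ ∑ i, U k i • state G c B K S₀ ξ₀ t i‖
      ≤ D * r ^ t * ∑ m, ‖∑ i, U m i • state G c B K S₀ ξ₀ t i‖ := by
  have hU1 : ∀ k i, |U k i| ≤ 1 := fun k i => by
    have h1 := hU i i
    rw [if_pos rfl] at h1
    have h2 := Finset.single_le_sum (f := fun k => U k i * U k i) (fun k _ => mul_self_nonneg _)
      (Finset.mem_univ k)
    exact abs_le_one_iff_mul_self_le_one.2 (h2.trans h1.le)
  set d : Fin N → ℝ := fun i => ∑ j, G.weight i j with hd
  have hd0 : ∀ i, 0 ≤ d i := fun i => Finset.sum_nonneg fun j _ => G.weight_nonneg i j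
  refine ⟨∑ i, C * (1 + ‖H‖ * (2 * d i)), Finset.sum_nonneg fun i _ => by
    have := hd0 i; positivity, fun t k => ?_⟩
  set ξ := state G c B K S₀ ξ₀ t with hξ
  set T := systemMatrix G c S₀ t with hT
  set Y := ∑ m, ‖∑ i, U m i • ξ i‖ with hY
  set ζ : Fin N → Fin p → ℝ := fun i => ∑ j, G.weight i j • (ξ j - ξ i) with hζ
  have hξY : ∀ i, ‖ξ i‖ ≤ Y := fun i => by
    rw [eq_sum_modes hU ξ i]
    refine norm_sum_le_of_le _ fun m _ => ?_
    rw [norm_smul, Real.norm_eq_abs]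
    exact mul_le_of_le_one_left (norm_nonneg _) (hU1 m i)
  have hζY : ∀ i, ‖ζ i‖ ≤ 2 * d i * Y := fun i => by
    calc ‖ζ i‖ ≤ ∑ j, G.weight i j * (Y + Y) := norm_sum_le_of_le _ fun j _ => by
          rw [norm_smul, Real.norm_of_nonneg (G.weight_nonneg i j)]
          exact mul_le_mul_of_nonneg_left ((norm_sub_le _ _).trans (add_le_add (hξY j) (hξY i)))
            (G.weight_nonneg i j)
      _ = _ := by rw [← Finset.sum_mul]; ring
  have hnext : ∀ i, state G c B K S₀ ξ₀ (t + 1) i = T i *ᵥ ξ i + (H * T i) *ᵥ ζ i := fun i => by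
    rw [← hK]
    rfl
  have hζmode : ∑ i, U k i • ζ i = -(l k • ∑ i, U k i • ξ i) := sum_smul_coupling G (hl k) ξ
  have hlin : ∀ (M : Matrix (Fin p) (Fin p) ℝ) (x : Fin N → Fin p → ℝ),
      M *ᵥ ∑ i, U k i • x i = ∑ i, U k i • (M *ᵥ x i) := fun M x => by
    simp only [Matrix.mulVec_sum, Matrix.mulVec_smul]
  -- With `S` in place of each `T i` the mode would evolve exactly, so only the deviations `T i - S`
  -- remain.
  have hdiff : ∑ i, U k i • state G c B K S₀ ξ₀ (t + 1) i
      - (S - l k • (H * S)) *ᵥ ∑ i, U k i • ξ i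
      = ∑ i, U k i • ((T i - S) *ᵥ ξ i + (H * (T i - S)) *ᵥ ζ i) := by
    have h1 : (S - l k • (H * S)) *ᵥ ∑ i, U k i • ξ i
        = ∑ i, U k i • (S *ᵥ ξ i + (H * S) *ᵥ ζ i) := by
      rw [Matrix.sub_mulVec, Matrix.smul_mulVec, ← Matrix.mulVec_smul, sub_eq_add_neg,
        ← Matrix.mulVec_neg, ← hζmode, hlin, hlin, ← Finset.sum_add_distrib]
      simp only [smul_add]
    rw [h1, ← Finset.sum_sub_distrib]
    refine Finset.sum_congr rfl fun i _ => ?_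
    rw [hnext, ← smul_sub, Matrix.mul_sub, Matrix.sub_mulVec, Matrix.sub_mulVec]
    congr 1
    abel
  rw [hdiff, Finset.sum_mul, Finset.sum_mul]
  refine norm_sum_le_of_le _ fun i _ => ?_
  have hTS := hS t i
  have hY0 : 0 ≤ Y := (norm_nonneg _).trans (hξY i)
  have hCr : 0 ≤ C * r ^ t := by positivity
  have hb1 : ‖(T i - S) *ᵥ ξ i‖ ≤ C * r ^ t * Y :=
    (Matrix.linfty_opNorm_mulVec _ _).trans
      (mul_le_mul hTS (hξY i) (norm_nonneg _) hCr)
  have hb2 : ‖(H * (T i - S)) *ᵥ ζ i‖ ≤ ‖H‖ * (C * r ^ t) * (2 * d i * Y) := by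
    refine (Matrix.linfty_opNorm_mulVec _ _).trans
      (mul_le_mul ((norm_mul_le _ _).trans ?_) (hζY i) (norm_nonneg _) (by positivity))
    exact mul_le_mul_of_nonneg_left hTS (norm_nonneg _)
  rw [norm_smul, Real.norm_eq_abs]
  calc |U k i| * ‖(T i - S) *ᵥ ξ i + (H * (T i - S)) *ᵥ ζ i‖
      ≤ ‖(T i - S) *ᵥ ξ i + (H * (T i - S)) *ᵥ ζ i‖ :=
        mul_le_of_le_one_left (norm_nonneg _) (hU1 k i)
    _ ≤ C * r ^ t * Y + ‖H‖ * (C * r ^ t) * (2 * d i * Y) :=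
        (norm_add_le _ _).trans (add_le_add hb1 hb2)
    _ = _ := by ring

/-- A solution of the modified Riccati inequality makes all closed loop matrices stable whose gain
deviates from the nominal one by at most the parameter of the inequality. -/
theorem SolvesRiccati.rho_lt_one [NeZero p] {A P : Matrix (Fin p) (Fin p) ℝ} {B : Fin p → ℝ}
    {η : ℝ} (h : SolvesRiccati A B η P) {g l : ℝ} (hη : |1 - g * l| ≤ η) :
    rho (A - l • (((g / (B ⬝ᵥ (P *ᵥ B))) • (vecMulVec B B * P)) * A)) < 1 := by
  obtain ⟨hP, hR⟩ := h
  refine rho_lt_one_of_lyapunov hP fun x hx => ?_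
  have h1 := hR.dotProduct_mulVec_pos hx
  rw [star_trivial, riccati_form _ _ hP.isHermitian] at h1
  set b := B ⬝ᵥ (P *ᵥ B) with hb
  set v := B ⬝ᵥ (P *ᵥ (A *ᵥ x)) with hv
  have hM : (A - l • (((g / b) • (vecMulVec B B * P)) * A)) *ᵥ x
      = A *ᵥ x - (l * (g / b) * v) • B := by
    rw [Matrix.sub_mulVec, Matrix.smul_mulVec, ← Matrix.mulVec_mulVec, Matrix.smul_mulVec,
      ← Matrix.mulVec_mulVec, Matrix.vecMulVec_mulVec, op_smul_eq_smul, smul_smul, smul_smul, ← hv]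
  rw [hM]
  simp only [Matrix.mulVec_sub, Matrix.mulVec_smul, dotProduct_sub, sub_dotProduct, smul_dotProduct,
    dotProduct_smul, smul_eq_mul, dotProduct_mulVec_symm hP.isHermitian (A *ᵥ x) B, ← hv, ← hb]
  have hb0 : 0 ≤ b := by simpa using hP.posSemidef.dotProduct_mulVec_nonneg B
  -- If `b = 0`, division by zero gives `0`: both feedback terms vanish and the inequality is
  -- already the Lyapunov one. Otherwise the closed loop decrease carries the coefficient `(1 - (1 -
  -- g * l) ^ 2) / b`, at least the one in the Riccati inequality.
  rcases hb0.eq_or_lt with hb0 | hb0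
  · rw [← hb0] at h1 ⊢
    simp only [div_zero, mul_zero, zero_mul, sub_zero, add_zero] at h1 ⊢
    linarith
  · have hsq : (1 - g * l) ^ 2 ≤ η ^ 2 := sq_le_sq' (by linarith [neg_abs_le (1 - g * l)])
      ((le_abs_self _).trans hη)
    have h2 : (1 - η ^ 2) / b * v ^ 2 ≤ (1 - (1 - g * l) ^ 2) / b * v ^ 2 := by gcongr
    refine lt_of_sub_pos (lt_of_lt_of_le h1 ?_)
    refine (add_le_add_right h2 _).trans (le_of_eq ?_)
    field_simp
    ring

/-- Synchronization of the agents for a coupling strength under which the system matrices converge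
fast enough, and a feedback built from a solution of the modified Riccati inequality. -/
theorem synchronizes_of_solvesRiccati (hN : 2 ≤ N) (G : WeightedGraph N) (hG : G.graph.Connected)
    {B : Fin p → ℝ} {S₀ : Fin N → Matrix (Fin p) (Fin p) ℝ} {lam2 lamN c η : ℝ}
    {h1N : 1 < N} {hlast : N - 1 < N} (hlam2 : lam2 = G.eigenvalue ⟨1, h1N⟩)
    (hlamN : lamN = G.eigenvalue ⟨N - 1, hlast⟩)
    (hrho : 1 ≤ rho (average S₀))
    (hc : c ∈ Set.Ioo ((1 - 1 / rho (average S₀)) / lam2) ((1 + 1 / rho (average S₀)) / lamN))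
    (hη : (lamN - lam2) / (lamN + lam2) ≤ η)
    {P : Matrix (Fin p) (Fin p) ℝ} (hP : SolvesRiccati (average S₀) B η P) :
    Synchronizes G c B (gain (2 / (lam2 + lamN)) B P) S₀ := by
  have hp : NeZero p := pos_of_one_le_rho hrho
  obtain ⟨U, l, k₀, u₀, hU, hl, hu₀, hNu, hl₀, hlk, h2pos, h2N⟩ :=
    G.exists_laplacian_eigenbasis hN hG h1N hlast
  rw [← hlam2] at h2pos
  rw [← hlam2, ← hlamN] at hlk h2N
  have hNpos : 0 < lamN := h2pos.trans_le h2N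
  set ρ := rho (average S₀) with hρ
  have hρ0 : 0 < ρ := zero_lt_one.trans_le hrho
  obtain ⟨hc1, hc2⟩ := hc
  rw [div_lt_iff₀ h2pos] at hc1
  rw [lt_div_iff₀ hNpos] at hc2
  have hρ1 : 1 / ρ ≤ 1 := by rw [div_le_one hρ0]; exact hrho
  have hc0 : 0 < c := pos_of_mul_pos_left (by linarith) h2pos.le
  -- The two ends of the interval for `c` say exactly that both quantities are below `1 / ρ`; the
  -- `0` makes `r` positive.
  obtain ⟨r, hr1, hr2⟩ : ∃ r, max (max (1 - c * lam2) (c * lamN - 1)) 0 < r ∧ r < 1 / ρ :=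
    exists_between (max_lt (max_lt (by linarith) (by linarith)) (by positivity))
  have hra : 1 - c * lam2 < r := (le_max_left _ _).trans_lt ((le_max_left _ _).trans_lt hr1)
  have hrb : c * lamN - 1 < r := (le_max_right _ _).trans_lt ((le_max_left _ _).trans_lt hr1)
  have hr0 : 0 < r := (le_max_right _ _).trans_lt hr1
  have hrρ : r * ρ < 1 := by rwa [lt_div_iff₀ hρ0] at hr2
  obtain ⟨C, hC, hS⟩ := exists_systemMatrix_bound (c := c) G hU hl hu₀ hNu hl₀ hr0.le
    (fun k hk => abs_le.2 ⟨by nlinarith [(hlk k hk).2], by nlinarith [(hlk k hk).1]⟩) S₀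
  intro ξ₀ i j
  obtain ⟨D, hD, hy⟩ := exists_mode_bound G hU hl hr0.le hC hS
    (gain_dotProduct_smul (2 / (lam2 + lamN)) B P) ξ₀
  -- The coefficient `U k i - U k j` vanishes for the constant mode, the only one that need not
  -- decay.
  have hdiff : ∀ t, state G c B (gain (2 / (lam2 + lamN)) B P) S₀ ξ₀ t i
      - state G c B (gain (2 / (lam2 + lamN)) B P) S₀ ξ₀ t j
      = ∑ k, (U k i - U k j) •
        ∑ m, U k m • state G c B (gain (2 / (lam2 + lamN)) B P) S₀ ξ₀ t m := fun t => by
    rw [eq_sum_modes hU (state G c B _ S₀ ξ₀ t) i, eq_sum_modes hU (state G c B _ S₀ ξ₀ t) j,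
      ← Finset.sum_sub_distrib]
    exact Finset.sum_congr rfl fun k _ => (sub_smul _ _ _).symm
  simp only [hdiff]
  clear hdiff
  generalize hyd : (fun t k =>
    ∑ m, U k m • state G c B (gain (2 / (lam2 + lamN)) B P) S₀ ξ₀ t m) = y at hy
  have hyk : ∀ t k, ∑ m, U k m • state G c B (gain (2 / (lam2 + lamN)) B P) S₀ ξ₀ t m = y t k :=
    fun t k => congrFun (congrFun hyd t) k
  simp only [hyk] at hy ⊢
  clear hyd hyk
  have hs : 0 < lam2 + lamN := by linarith
  have hlim : ∀ k, k ≠ k₀ → Tendsto (fun t => y t k) atTop (𝓝 0) := fun k hk => by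
    refine tendsto_zero_of_perturbed_modes (k₀ := k₀) hr0 (by linarith) hD (fun k hk => ?_) ?_ hy hk
    · refine hP.rho_lt_one ((abs_le.2 ?_).trans hη)
      obtain ⟨h1, h2⟩ := hlk k hk
      have e1 : 1 - 2 / (lam2 + lamN) * l k = (lam2 + lamN - 2 * l k) / (lamN + lam2) := by
        rw [add_comm lamN]; field_simp
      rw [e1, ← neg_div]
      exact ⟨div_le_div_of_nonneg_right (by linarith) (by linarith),
        div_le_div_of_nonneg_right (by linarith) (by linarith)⟩
    · simp only [hl₀, zero_smul, sub_zero]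
      exact hrρ
  have hsum : Tendsto (fun t => ∑ k, (U k i - U k j) • y t k) atTop
      (𝓝 (∑ _k : Fin N, (0 : Fin p → ℝ))) := by
    refine tendsto_finsetSum _ fun k _ => ?_
    by_cases hk : k = k₀
    · subst hk
      simp [hu₀]
    · simpa using (hlim k hk).const_smul (U k i - U k j)
  rw [Finset.sum_const_zero] at hsum
  have hcont : Continuous fun x : Fin p → ℝ => ‖WithLp.toLp 2 x‖ := by fun_prop
  have h := (hcont.tendsto 0).comp hsum
  rw [WithLp.toLp_zero, norm_zero] at h
  exact h

end Synchronization

end MultiAgent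

theorem theorem2 {N p : ℕ} (hN : 2 ≤ N) (G : WeightedGraph N) (hG : G.graph.Connected)
    (B : Fin p → ℝ) (S₀ : Fin N → Matrix (Fin p) (Fin p) ℝ)
    (Sinf : Matrix (Fin p) (Fin p) ℝ) (hSinf : Sinf = MultiAgent.average S₀)
    (lam2 lamN : ℝ)
    (hlam2 : lam2 = G.eigenvalue ⟨1, by omega⟩) (hlamN : lamN = G.eigenvalue ⟨N - 1, by omega⟩)
    (hstab : MultiAgent.Stabilizable Sinf B)
    (hrho : 1 ≤ MultiAgent.rho Sinf)
    (hprod : (lamN - lam2) / (lamN + lam2) < (MultiAgent.unstableProd Sinf)⁻¹) :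
    -- some coupling strength and some feedback law depending only on `S_i(t)` synchronize
    (∃ (c : ℝ) (K : Matrix (Fin p) (Fin p) ℝ → Fin p → ℝ),
      MultiAgent.Synchronizes G c B K S₀) ∧
    -- the proposed coupling strengths and gains exist
    (Set.Ioo ((1 - 1 / MultiAgent.rho Sinf) / lam2)
      ((1 + 1 / MultiAgent.rho Sinf) / lamN)).Nonempty ∧
    (∀ η ∈ Set.Ico ((lamN - lam2) / (lamN + lam2)) (MultiAgent.unstableProd Sinf)⁻¹,
      ∃ P : Matrix (Fin p) (Fin p) ℝ, MultiAgent.SolvesRiccati Sinf B η P) ∧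
    -- every one of them synchronizes the agents
    (∀ c ∈ Set.Ioo ((1 - 1 / MultiAgent.rho Sinf) / lam2)
        ((1 + 1 / MultiAgent.rho Sinf) / lamN),
      ∀ η ∈ Set.Ico ((lamN - lam2) / (lamN + lam2)) (MultiAgent.unstableProd Sinf)⁻¹,
      ∀ P : Matrix (Fin p) (Fin p) ℝ, MultiAgent.SolvesRiccati Sinf B η P →
        MultiAgent.Synchronizes G c B (MultiAgent.gain (2 / (lam2 + lamN)) B P) S₀) := by
  subst hSinf
  have hp : NeZero p := MultiAgent.pos_of_one_le_rho hrho
  obtain ⟨-, -, -, -, -, -, -, -, -, -, h2pos, h2N⟩ := G.exists_laplacian_eigenbasis hN hG (by omega) (by omega)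
  rw [← hlam2] at h2pos
  rw [← hlam2, ← hlamN] at h2N
  have hNpos : 0 < lamN := h2pos.trans_le h2N
  have hη₀ : 0 ≤ (lamN - lam2) / (lamN + lam2) := div_nonneg (by linarith) (by linarith)
  have hsolve : ∀ η ∈ Set.Ico ((lamN - lam2) / (lamN + lam2))
      (MultiAgent.unstableProd (MultiAgent.average S₀))⁻¹,
      ∃ P : Matrix (Fin p) (Fin p) ℝ, MultiAgent.SolvesRiccati (MultiAgent.average S₀) B η P :=
    fun η hη => MultiAgent.exists_solvesRiccati hstab hrho (hη₀.trans hη.1) hη.2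
  have hsync : ∀ c ∈ Set.Ioo ((1 - 1 / MultiAgent.rho (MultiAgent.average S₀)) / lam2)
        ((1 + 1 / MultiAgent.rho (MultiAgent.average S₀)) / lamN),
      ∀ η ∈ Set.Ico ((lamN - lam2) / (lamN + lam2))
        (MultiAgent.unstableProd (MultiAgent.average S₀))⁻¹,
      ∀ P : Matrix (Fin p) (Fin p) ℝ, MultiAgent.SolvesRiccati (MultiAgent.average S₀) B η P →
        MultiAgent.Synchronizes G c B (MultiAgent.gain (2 / (lam2 + lamN)) B P) S₀ :=
    fun c hc η hη P hP =>
      MultiAgent.synchronizes_of_solvesRiccati hN G hG hlam2 hlamN hrho hc hη.1 hP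
  have hne : (Set.Ioo ((1 - 1 / MultiAgent.rho (MultiAgent.average S₀)) / lam2)
      ((1 + 1 / MultiAgent.rho (MultiAgent.average S₀)) / lamN)).Nonempty := by
    have hρ0 : 0 < MultiAgent.rho (MultiAgent.average S₀) := zero_lt_one.trans_le hrho
    -- After clearing denominators this is the inequality between the two endpoints of the interval.
    have h1 : (lamN - lam2) / (lamN + lam2) < 1 / MultiAgent.rho (MultiAgent.average S₀) := by
      rw [one_div]
      exact hprod.trans_le (inv_anti₀ hρ0 (MultiAgent.rho_le_unstableProd hrho))
    rw [div_lt_iff₀ (by linarith)] at h1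
    rw [Set.nonempty_Ioo, div_lt_div_iff₀ h2pos hNpos]
    linarith
  refine ⟨?_, hne, hsolve, hsync⟩
  obtain ⟨c, hc⟩ := hne
  obtain ⟨P, hP⟩ := hsolve _ ⟨le_rfl, hprod⟩
  exact ⟨c, _, hsync c hc _ ⟨le_rfl, hprod⟩ P hP⟩
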